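/- For $X\subset\mathbb{R}^d$ write $|X|$ for its Lebesgue (outer) measure, $\operatorname{co}(X)$ for its convex hull and $k\cdot X:=\{x_1+\dots+x_k : x_1,\dots,x_k\in X\}$ for its $k$-fold sumset. For all integers $d,k\ge 1$ there is a constant $C_{d,k}>0$, depending only on $d$ and $k$, such that every Lebesgue measurable set $A\subset\mathbb{R}^d$ with $|k\cdot A|<(1^d+2^d+\dots+k^d)\,|A|$ satisfies $|\operatorname{co}(A)|\le C_{d,k}|A|$. The threshold is sharp: for all integers $d,k\ge 1$ and every $C\in\mathbb{R}$ there is a compact set $A\subset\mathbb{R}^d$ with $|A|>0$, $|k\cdot A|=(1^d+2^d+\dots+k^d)\,|A|$ and $|\operatorname{co}(A)|>C|A|$. -/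

import Mathlib

open MeasureTheory
open scoped ENNReal

/-- The `k`-fold sumset `A + ⋯ + A` (`k` terms): all sums `a₁ + ⋯ + aₖ` with every `aᵢ` in `A`. -/
def kFoldSumset {E : Type*} [AddCommMonoid E] (k : ℕ) (A : Set E) : Set E :=
  {x | ∃ a : Fin k → E, (∀ i, a i ∈ A) ∧ ∑ i, a i = x}

/-!
The heart of the matter is a compact set `A`, for which the claim is that `|kA| < (1ᵈ + ⋯ + kᵈ)|A|`
forces `A` to fill a fixed proportion of its convex hull.

*Long fibres.* Let `e` be a basis vector and `L` the length of the longest chord of `A` parallel to `e`, with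
end points `a` and `a + L e`; translate so that `a = 0`. Suppose that all fibres of `A` parallel to
`e` have length at most `L / k`. Let `A*` be the compression of `A` along `e`, that is, push each
fibre to an initial segment `[0, ℓ]`. Since `jA` and `jA + L e` are both in `(j + 1)A`, each fibre of
`(j + 1)A` is longer than that of `jA` by at least the measure of its own projection to the
circle `ℝ / L ℤ` (`AddCircle.volume_add_volume_image_coe_le`). By Raikov's inequality on the circle
(`AddCircle.min_le_volume_add`, deduced from the Cauchy-Davenport theorem) that projection is at
least as long as the fibre of `(j + 1)A*`; here the bound `L / k` excludes wrapping around. Hence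
`|(j + 1)A| ≥ |jA| + |(j + 1)A*| ≥ |jA| + (j + 1)ᵈ|A|`, and `|kA| ≥ (1ᵈ + ⋯ + kᵈ)|A|`. So a set with
smaller `k`-fold sumset has a fibre of length more than `L / k` (`exists_long_coordFiber`).

*Compression.* After an affine change of coordinates sending a simplex of maximal volume with vertices
in `A` to the standard simplex, `A` lies in `[-1, 1]ᵈ` and contains `0` and the basis vectors
(`exists_affine_normalisation`). Compression preserves the measure and does not increase that of
the `k`-fold sumset. Compressing along all coordinates in turn yields a down-set `D ⊆ [0, 2]ᵈ` with
`|D| = |A|` and `|kD| < (1ᵈ + ⋯ + kᵈ)|D|` that contains `(1 / k) eᵢ` for each `i`, by the existence of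
long fibres at each stage (`exists_compression`). A down-set with small doubling that reaches out that
far has measure bounded below, by induction on the dimension
(`exists_le_volume_of_isOrthantDownSet`), whereas the hull of the normalised set has measure at
most `2ᵈ`.

*General sets.* The compact case applies to `Q ∪ F`, with `Q ⊆ A` compact of nearly full measure and
`F ⊆ A` finite, and the measure of the hull of `A` is the supremum of those of the hulls of its finite
subsets (`volume_convexHull_le_of_finite`).

*Sharpness.* For `A = [0, 1]ᵈ ∪ {p}` with `p` far away, `kA` is the disjoint union of translates of the
cubes `[0, j]ᵈ` for `0 ≤ j ≤ k`.
-/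

open Filter Topology
open scoped Pointwise

/-! ### Sumset inequalities on the line and on the circle -/

lemma Real.volume_add_volume_le_volume_add {S T : Set ℝ} (hS : IsCompact S) (hT : IsCompact T)
    (hS' : S.Nonempty) (hT' : T.Nonempty) : volume S + volume T ≤ volume (S + T) := by
  obtain ⟨a, ha, ha'⟩ := hS.exists_isGreatest hS'
  obtain ⟨b, hb, hb'⟩ := hT.exists_isLeast hT'
  have h1 : volume ((fun x => x + b) '' S) = volume S := by
    simp
  have h2 : volume ((fun x => a + x) '' T) = volume T := by
    simp
  have hm : IsCompact ((fun x => a + x) '' T) := hT.image (by fun_prop)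
  rw [← h1, ← h2, ← measure_union₀ hm.measurableSet.nullMeasurableSet]
  · apply measure_mono
    rintro _ (⟨x, hx, rfl⟩ | ⟨x, hx, rfl⟩)
    · exact Set.add_mem_add hx hb
    · exact Set.add_mem_add ha hx
  · apply measure_mono_null (t := {a + b}) _ (by simp)
    rintro _ ⟨⟨x, hx, rfl⟩, ⟨y, hy, h⟩⟩
    have := ha' hx
    have := hb' hy
    simp only [Set.mem_singleton_iff] at *
    linarith

section Circle

variable {L : ℝ} [hL : Fact (0 < L)]

/-- The index of the arc, among the `p` arcs `[a L / p, (a + 1) L / p)` partitioning the circle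
`ℝ / L ℤ`, that contains a given point. -/
noncomputable def AddCircle.arcIndex (L : ℝ) [hL : Fact (0 < L)] (p : ℕ) : AddCircle L → ZMod p :=
  Function.Periodic.lift (f := fun t : ℝ => ((⌊t * p / L⌋ : ℤ) : ZMod p)) (by
    intro t
    have : (t + L) * p / L = t * p / L + p := by
      have := hL.out.ne'
      field_simp
    simp only [this, Int.floor_add_natCast]
    simp)

lemma AddCircle.arcIndex_coe (p : ℕ) (t : ℝ) :
    AddCircle.arcIndex L p (t : AddCircle L) = ((⌊t * p / L⌋ : ℤ) : ZMod p) := rfl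

lemma AddCircle.measurable_arcIndex (p : ℕ) : Measurable (AddCircle.arcIndex L p) := by
  apply QuotientAddGroup.measurable_from_quotient.2
  have : (AddCircle.arcIndex L p ∘ (QuotientAddGroup.mk : ℝ → AddCircle L))
      = (fun n : ℤ => (n : ZMod p)) ∘ fun t : ℝ => ⌊t * p / L⌋ := rfl
  rw [this]
  exact (measurable_of_countable _).comp (Int.measurable_floor.comp (by fun_prop))

lemma AddCircle.volume_arcIndex_preimage (p : ℕ) [NeZero p] (a : ZMod p) :
    volume (AddCircle.arcIndex L p ⁻¹' {a}) = ENNReal.ofReal (L / p) := by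
  have hp : (p : ℝ) ≠ 0 := by exact_mod_cast NeZero.ne p
  have hL0 := hL.out.ne'
  have shift : ∀ (n : ℤ), volume (AddCircle.arcIndex L p ⁻¹' {(n : ZMod p)})
      = volume (AddCircle.arcIndex L p ⁻¹' {0}) := by
    intro n
    rw [← measure_preimage_add_right volume ((n * L / p : ℝ) : AddCircle L)
      (AddCircle.arcIndex L p ⁻¹' {(n : ZMod p)})]
    congr 1
    ext x
    induction x using QuotientAddGroup.induction_on with | H t => ?_
    simp only [Set.mem_preimage, Set.mem_singleton_iff]
    rw [← AddCircle.coe_add, AddCircle.arcIndex_coe, AddCircle.arcIndex_coe]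
    have : (t + n * L / p) * p / L = t * p / L + n := by
      field_simp
    rw [this, Int.floor_add_intCast]
    simp
  have same : ∀ b : ZMod p, volume (AddCircle.arcIndex L p ⁻¹' {b})
      = volume (AddCircle.arcIndex L p ⁻¹' {0}) := by
    intro b
    obtain ⟨n, rfl⟩ := ZMod.intCast_surjective b
    exact shift n
  have htot : ∑ b : ZMod p, volume (AddCircle.arcIndex L p ⁻¹' {b}) = ENNReal.ofReal L := by
    rw [sum_measure_preimage_singleton _
      fun b _ => AddCircle.measurable_arcIndex p (measurableSet_singleton b)]
    simp
  rw [Finset.sum_congr rfl fun b _ => same b, Finset.sum_const, Finset.card_univ, ZMod.card,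
    nsmul_eq_mul] at htot
  rw [same, ENNReal.ofReal_div_of_pos (by positivity), ← htot, ENNReal.ofReal_natCast,
    mul_comm, ENNReal.mul_div_cancel_right (by exact_mod_cast NeZero.ne p) (by simp)]

/-- Up to an error of two arc lengths, addition on the circle is addition of arc indices. -/
lemma AddCircle.norm_sub_add_le_of_arcIndex (p : ℕ) [NeZero p] {x y z : AddCircle L}
    (h : AddCircle.arcIndex L p z = AddCircle.arcIndex L p x + AddCircle.arcIndex L p y) :
    ‖z - (x + y)‖ ≤ 2 * L / p := by
  have hp : (0 : ℝ) < p := by exact_mod_cast NeZero.pos p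
  have hL0 := hL.out
  induction x using QuotientAddGroup.induction_on with | H x => ?_
  induction y using QuotientAddGroup.induction_on with | H y => ?_
  induction z using QuotientAddGroup.induction_on with | H z => ?_
  rw [AddCircle.arcIndex_coe, AddCircle.arcIndex_coe, AddCircle.arcIndex_coe, ← Int.cast_add,
    ZMod.intCast_eq_intCast_iff_dvd_sub] at h
  obtain ⟨m, hm⟩ := h
  have key : ((z : AddCircle L) - ((x : AddCircle L) + (y : AddCircle L)))
      = ((z - (x + y) + m * L : ℝ) : AddCircle L) := by
    have : ((m * L : ℝ) : AddCircle L) = 0 :=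
      (AddCircle.coe_eq_zero_iff L).2 ⟨m, by simp⟩
    rw [AddCircle.coe_add, AddCircle.coe_sub, AddCircle.coe_add, this, add_zero]
  change ‖(z : AddCircle L) - ((x : AddCircle L) + (y : AddCircle L))‖ ≤ _
  rw [key]
  refine (QuotientAddGroup.norm_mk_le_norm).trans ?_
  have hm' : ((⌊x * p / L⌋ : ℝ) + ⌊y * p / L⌋ - ⌊z * p / L⌋) = p * m := by exact_mod_cast hm
  have e : z - (x + y) + m * L = (z * p / L - (x * p / L + y * p / L) + p * m) * (L / p) := by
    field_simp
  rw [e, ← hm', Real.norm_eq_abs, abs_mul, abs_of_pos (by positivity : 0 < L / p), mul_div_assoc 2]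
  gcongr
  have := Int.floor_le (x * p / L)
  have := Int.floor_le (y * p / L)
  have := Int.floor_le (z * p / L)
  have := Int.lt_floor_add_one (x * p / L)
  have := Int.lt_floor_add_one (y * p / L)
  have := Int.lt_floor_add_one (z * p / L)
  rw [abs_le]
  constructor <;> linarith

/-- The discretised form of the sumset inequality on the circle: the Cauchy-Davenport theorem for
the arcs meeting `S` and `T`. -/
lemma AddCircle.min_le_volume_cthickening_add {S T : Set (AddCircle L)} (hS : S.Nonempty)
    (hT : T.Nonempty) {p : ℕ} (hp : p.Prime) :
    min (ENNReal.ofReal L) (volume S + volume T - ENNReal.ofReal (L / p)) ≤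
      volume (Metric.cthickening (2 * L / p) (S + T)) := by
  classical
  have : NeZero p := ⟨hp.ne_zero⟩
  have hp0 : (0 : ℝ) < p := by exact_mod_cast hp.pos
  set c := AddCircle.arcIndex L p
  let F : Set (AddCircle L) → Finset (ZMod p) := fun X => Finset.univ.filter fun a => a ∈ c '' X
  have cover : ∀ X, volume X ≤ (F X).card * ENNReal.ofReal (L / p) := by
    intro X
    calc volume X ≤ volume (⋃ a ∈ F X, c ⁻¹' {a}) := by
          apply measure_mono
          intro x hx
          simp only [Set.mem_iUnion]
          exact ⟨c x, by simpa [F] using ⟨x, hx, rfl⟩, rfl⟩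
      _ ≤ ∑ a ∈ F X, volume (c ⁻¹' {a}) := measure_biUnion_finset_le _ _
      _ = _ := by
          rw [Finset.sum_congr rfl fun a _ => AddCircle.volume_arcIndex_preimage p a]
          simp
  have hFS : (F S).Nonempty := by
    obtain ⟨x, hx⟩ := hS
    exact ⟨c x, by simpa [F] using ⟨x, hx, rfl⟩⟩
  have hFT : (F T).Nonempty := by
    obtain ⟨x, hx⟩ := hT
    exact ⟨c x, by simpa [F] using ⟨x, hx, rfl⟩⟩
  have lower : ((F S + F T).card : ℝ≥0∞) * ENNReal.ofReal (L / p)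
      ≤ volume (Metric.cthickening (2 * L / p) (S + T)) := by
    calc ((F S + F T).card : ℝ≥0∞) * ENNReal.ofReal (L / p)
        = ∑ a ∈ F S + F T, volume (c ⁻¹' {a}) := by
          rw [Finset.sum_congr rfl fun a _ => AddCircle.volume_arcIndex_preimage p a]
          simp
      _ = volume (c ⁻¹' (F S + F T : Finset (ZMod p))) :=
          sum_measure_preimage_singleton _
            fun b _ => AddCircle.measurable_arcIndex p (measurableSet_singleton b)
      _ ≤ _ := by
          apply measure_mono
          intro z hz
          simp only [Set.mem_preimage, Finset.mem_coe] at hz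
          obtain ⟨a, ha, b, hb, hab⟩ := Finset.mem_add.1 hz
          simp only [F, Finset.mem_filter, Finset.mem_univ, true_and] at ha hb
          obtain ⟨x, hx, rfl⟩ := ha
          obtain ⟨y, hy, rfl⟩ := hb
          apply Metric.mem_cthickening_of_dist_le z (x + y) _ _ (Set.add_mem_add hx hy)
          rw [dist_eq_norm]
          exact AddCircle.norm_sub_add_le_of_arcIndex p hab.symm
  refine le_trans ?_ lower
  have hCD := ZMod.cauchy_davenport hp hFS hFT
  have hpL : (p : ℝ≥0∞) * ENNReal.ofReal (L / p) = ENNReal.ofReal L := by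
    rw [← ENNReal.ofReal_natCast, ← ENNReal.ofReal_mul hp0.le]
    congr 1
    field_simp
  rcases min_le_iff.1 hCD with h | h
  · refine (min_le_left _ _).trans ?_
    rw [← hpL]
    gcongr
  · refine (min_le_right _ _).trans ?_
    rw [tsub_le_iff_right]
    refine (add_le_add (cover S) (cover T)).trans ?_
    rw [← add_mul, ← add_one_mul]
    have : (F S).card + (F T).card ≤ (F S + F T).card + 1 := by omega
    exact mul_le_mul_left (by exact_mod_cast this) _

/-- Raikov's inequality (the Cauchy-Davenport theorem for the circle). -/
lemma AddCircle.min_le_volume_add {S T : Set (AddCircle L)} (hS : IsCompact S) (hT : IsCompact T)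
    (hS' : S.Nonempty) (hT' : T.Nonempty) :
    min (ENNReal.ofReal L) (volume S + volume T) ≤ volume (S + T) := by
  obtain ⟨u, hu, hu'⟩ : ∃ u : ℕ → ℕ, Tendsto u atTop atTop ∧ ∀ n, (u n).Prime := by
    choose u hu hu' using Nat.exists_infinite_primes
    exact ⟨u, tendsto_atTop_mono hu tendsto_id, hu'⟩
  have hu2 : Tendsto (fun n => ((u n : ℕ) : ℝ)) atTop atTop :=
    tendsto_natCast_atTop_atTop.comp hu
  have h1 : Tendsto (fun n => volume (Metric.cthickening (2 * L / u n) (S + T))) atTop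
      (𝓝 (volume (S + T))) :=
    (tendsto_measure_cthickening_of_isCompact (hS.add hT)).comp (hu2.const_div_atTop _)
  have h2 : Tendsto (fun n => min (ENNReal.ofReal L)
      (volume S + volume T - ENNReal.ofReal (L / u n))) atTop
      (𝓝 (min (ENNReal.ofReal L) (volume S + volume T - ENNReal.ofReal 0))) := by
    refine tendsto_const_nhds.min (ENNReal.Tendsto.sub tendsto_const_nhds
      (ENNReal.tendsto_ofReal (hu2.const_div_atTop _)) (Or.inr (by simp)))
  simp only [ENNReal.ofReal_zero, tsub_zero] at h2
  exact le_of_tendsto_of_tendsto' h2 h1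
    fun n => AddCircle.min_le_volume_cthickening_add hS' hT' (hu' n)

/-- A set of diameter at most `L` does not lose measure when it is projected to `ℝ / L ℤ`. -/
lemma AddCircle.volume_le_volume_image_coe {S : Set ℝ} {a : ℝ} (hS : MeasurableSet S)
    (h : S ⊆ Set.Icc a (a + L)) :
    volume S ≤ volume ((fun t : ℝ => (t : AddCircle L)) '' S) := by
  calc volume S ≤ volume (S ∩ Set.Ioc a (a + L) ∪ {a}) := by
        apply measure_mono
        intro x hx
        rcases (h hx).1.eq_or_lt with h' | h'
        · right; simp [h']
        · left; exact ⟨hx, h', (h hx).2⟩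
    _ ≤ volume (S ∩ Set.Ioc a (a + L)) + volume {a} := measure_union_le _ _
    _ = (volume.restrict (Set.Ioc a (a + L))) S := by
        simp [Measure.restrict_apply hS]
    _ ≤ (volume.restrict (Set.Ioc a (a + L)))
        ((fun t : ℝ => (t : AddCircle L)) ⁻¹' ((fun t : ℝ => (t : AddCircle L)) '' S)) :=
        measure_mono (Set.subset_preimage_image _ _)
    _ ≤ _ := (AddCircle.measurePreserving_mk L a).measure_preimage_le _

lemma AddCircle.volume_image_coe_le {E : Set ℝ} (hE : MeasurableSet E) :
    volume ((fun t : ℝ => (t : AddCircle L)) '' E) ≤ volume E := by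
  set I : ℤ → Set ℝ := fun n => Set.Ioc (0 + n • L) (0 + (n + 1) • L) with hI
  have hIL : ∀ n, I n = Set.Ioc (n • L) (n • L + L) := by
    intro n; simp only [hI, add_zsmul, one_zsmul, zero_add]
  have piece : ∀ n, volume ((fun t : ℝ => (t : AddCircle L)) '' (E ∩ I n)) ≤ volume (E ∩ I n) := by
    intro n
    have him : (fun t : ℝ => (t : AddCircle L)) '' (E ∩ I n)
        = (AddCircle.measurableEquivIoc L (n • L)) ⁻¹' (Subtype.val ⁻¹' E) := by
      ext z
      simp only [Set.mem_image, Set.mem_preimage, hIL]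
      constructor
      · rintro ⟨t, ⟨ht, ht'⟩, rfl⟩
        have : AddCircle.measurableEquivIoc L (n • L) (t : AddCircle L) = ⟨t, ht'⟩ :=
          AddCircle.equivIoc_coe_eq ht'
        rw [this]
        exact ht
      · intro hz
        refine ⟨_, ⟨hz, (AddCircle.measurableEquivIoc L (n • L) z).2⟩, ?_⟩
        exact (AddCircle.measurableEquivIoc L (n • L)).symm_apply_apply z
    have hmeas : MeasurableSet ((fun t : ℝ => (t : AddCircle L)) '' (E ∩ I n)) := by
      rw [him]
      exact (AddCircle.measurableEquivIoc L (n • L)).measurable (measurable_subtype_coe hE)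
    rw [AddCircle.add_projection_respects_measure L (n • L) hmeas]
    apply measure_mono
    rintro t ⟨⟨s, ⟨hs, hs'⟩, hst⟩, ht⟩
    rw [hIL] at hs' ⊢
    have h1 := AddCircle.equivIoc_coe_eq (p := L) hs'
    have h2 := AddCircle.equivIoc_coe_eq (p := L) ht
    have : (⟨s, hs'⟩ : Set.Ioc (n • L) (n • L + L)) = ⟨t, ht⟩ := by
      rw [← h1, ← h2]
      exact congrArg _ hst
    obtain rfl := congrArg Subtype.val this
    exact ⟨hs, hs'⟩
  have hU : E = ⋃ n, E ∩ I n := by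
    rw [← Set.inter_iUnion, iUnion_Ioc_add_zsmul hL.out, Set.inter_univ]
  have hd : Pairwise (Function.onFun Disjoint fun n => E ∩ I n) := fun m n hmn =>
    (Set.pairwise_disjoint_Ioc_add_zsmul 0 L hmn).mono Set.inter_subset_right
      Set.inter_subset_right
  calc volume ((fun t : ℝ => (t : AddCircle L)) '' E)
      = volume (⋃ n, (fun t : ℝ => (t : AddCircle L)) '' (E ∩ I n)) := by
        rw [← Set.image_iUnion, ← hU]
    _ ≤ ∑' n, volume ((fun t : ℝ => (t : AddCircle L)) '' (E ∩ I n)) := measure_iUnion_le _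
    _ ≤ ∑' n, volume (E ∩ I n) := ENNReal.tsum_le_tsum piece
    _ = volume E := by
        rw [← measure_iUnion hd fun n => hE.inter measurableSet_Ioc, ← hU]

/-- If `G'` contains `G` and `G + L`, then `G' \ G` still meets every class modulo `L` that `G'`
meets: a class meeting `G` has a largest element in `G`, and its translate by `L` is in `G' \ G`. -/
lemma AddCircle.volume_add_volume_image_coe_le {G G' : Set ℝ} (hG : MeasurableSet G)
    (hG' : MeasurableSet G') (hbdd : BddAbove G) (hsub : G ⊆ G')
    (hshift : ∀ t ∈ G, t + L ∈ G') :
    volume G + volume ((fun t : ℝ => (t : AddCircle L)) '' G') ≤ volume G' := by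
  have himage : (fun t : ℝ => (t : AddCircle L)) '' G' ⊆
      (fun t : ℝ => (t : AddCircle L)) '' (G' \ G) := by
    rintro _ ⟨t, ht, rfl⟩
    by_cases htG : t ∈ G
    · obtain ⟨b, hb⟩ := hbdd
      have hex : ∃ n : ℕ, t + n * L ∉ G := by
        obtain ⟨n, hn⟩ := exists_nat_gt ((b - t) / L)
        refine ⟨n, fun h => ?_⟩
        have := hb h
        rw [div_lt_iff₀ hL.out] at hn
        linarith
      classical
      obtain ⟨m, hm⟩ : ∃ m, Nat.find hex = m + 1 := by
        apply Nat.exists_eq_succ_of_ne_zero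
        intro h0
        exact (Nat.find_eq_zero hex).1 h0 (by simpa using htG)
      have h1 : t + m * L ∈ G := not_not.1 (Nat.find_min hex (m := m) (by omega))
      have h2 := Nat.find_spec hex
      rw [hm] at h2
      refine ⟨t + (m + 1 : ℕ) * L, ⟨?_, h2⟩, ?_⟩
      · have := hshift _ h1
        convert this using 1
        push_cast
        ring
      · have : (((m + 1 : ℕ) * L : ℝ) : AddCircle L) = 0 :=
          (AddCircle.coe_eq_zero_iff L).2 ⟨(m + 1 : ℕ), by simp⟩
        simp only [AddCircle.coe_add, this, add_zero]
    · exact ⟨t, ⟨ht, htG⟩, rfl⟩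
  calc volume G + volume ((fun t : ℝ => (t : AddCircle L)) '' G')
      ≤ volume G + volume (G' \ G) := by
        gcongr
        exact (measure_mono himage).trans (AddCircle.volume_image_coe_le (hG'.diff hG))
    _ = volume G' := by
        rw [measure_add_sdiff hG.nullMeasurableSet, Set.union_eq_self_of_subset_left hsub]

end Circle

/-! ### Elementary properties of iterated sumsets -/

section Sumset

variable {E F : Type*} [AddCommMonoid E] [AddCommMonoid F]

lemma kFoldSumset_zero (A : Set E) : kFoldSumset 0 A = {0} := by
  ext x
  simp [kFoldSumset, eq_comm]

lemma kFoldSumset_one (A : Set E) : kFoldSumset 1 A = A := by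
  ext x
  constructor
  · rintro ⟨a, ha, rfl⟩
    simpa using ha 0
  · intro hx
    exact ⟨fun _ => x, fun _ => hx, by simp⟩

lemma kFoldSumset_succ (k : ℕ) (A : Set E) :
    kFoldSumset (k + 1) A = kFoldSumset k A + A := by
  ext x
  rw [Set.mem_add]
  constructor
  · rintro ⟨a, ha, rfl⟩
    exact ⟨_, ⟨fun i => a i.castSucc, fun i => ha _, rfl⟩, a (Fin.last k), ha _,
      (Fin.sum_univ_castSucc a).symm⟩
  · rintro ⟨_, ⟨a, ha, rfl⟩, y, hy, rfl⟩
    refine ⟨Fin.snoc a y, fun i => ?_, by simp [Fin.sum_univ_castSucc]⟩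
    induction i using Fin.lastCases with
    | last => simpa using hy
    | cast i => simpa using ha i

lemma kFoldSumset_mono (k : ℕ) {A B : Set E} (h : A ⊆ B) : kFoldSumset k A ⊆ kFoldSumset k B := by
  rintro _ ⟨a, ha, rfl⟩
  exact ⟨a, fun i => h (ha i), rfl⟩

lemma add_self_subset_kFoldSumset {A : Set E} (h0 : 0 ∈ A) {k : ℕ} (hk : 2 ≤ k) :
    A + A ⊆ kFoldSumset k A := by
  induction k, hk using Nat.le_induction with
  | base => rw [kFoldSumset_succ, kFoldSumset_one]
  | succ k hk ih =>
    rw [kFoldSumset_succ]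
    intro x hx
    simpa using Set.add_mem_add (ih hx) h0

lemma nsmul_mem_kFoldSumset (k : ℕ) {A : Set E} {x : E} (hx : x ∈ A) :
    k • x ∈ kFoldSumset k A :=
  ⟨fun _ => x, fun _ => hx, by simp⟩

lemma kFoldSumset_image (k : ℕ) (f : E →+ F) (A : Set E) :
    kFoldSumset k (f '' A) = f '' kFoldSumset k A := by
  ext y
  constructor
  · rintro ⟨b, hb, rfl⟩
    choose a ha hab using hb
    exact ⟨_, ⟨a, ha, rfl⟩, by simp [hab]⟩
  · rintro ⟨_, ⟨a, ha, rfl⟩, rfl⟩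
    exact ⟨fun i => f (a i), fun i => ⟨a i, ha i, rfl⟩, by simp⟩

lemma kFoldSumset_image_add_right (k : ℕ) (A : Set E) (c : E) :
    kFoldSumset k ((fun x => x + c) '' A) = (fun x => x + k • c) '' kFoldSumset k A := by
  ext y
  constructor
  · rintro ⟨b, hb, rfl⟩
    choose a ha hab using hb
    exact ⟨_, ⟨a, ha, rfl⟩, by simp [← hab, Finset.sum_add_distrib]⟩
  · rintro ⟨_, ⟨a, ha, rfl⟩, rfl⟩
    exact ⟨fun i => a i + c, fun i => ⟨a i, ha i, rfl⟩, by simp [Finset.sum_add_distrib]⟩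

lemma IsCompact.kFoldSumset [TopologicalSpace E] [ContinuousAdd E] {A : Set E} (hA : IsCompact A)
    (k : ℕ) : IsCompact (kFoldSumset k A) := by
  induction k with
  | zero =>
    rw [kFoldSumset_zero]
    exact isCompact_singleton
  | succ k ih => rw [kFoldSumset_succ]; exact ih.add hA

end Sumset

/-! ### Compression along a coordinate -/

section Compression

variable {ι : Type*} [DecidableEq ι]

/-- The fibre of `X` through `x` in the direction of the coordinate `i`, as a subset of the line. -/
def coordFiber (i : ι) (X : Set (ι → ℝ)) (x : ι → ℝ) : Set ℝ :=
  {t | Function.update x i t ∈ X}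

@[simp] lemma mem_coordFiber {i : ι} {X : Set (ι → ℝ)} {x : ι → ℝ} {t : ℝ} :
    t ∈ coordFiber i X x ↔ Function.update x i t ∈ X := Iff.rfl

lemma coordFiber_update (i : ι) (X : Set (ι → ℝ)) (x : ι → ℝ) (t : ℝ) :
    coordFiber i X (Function.update x i t) = coordFiber i X x := by
  ext s; simp

lemma self_mem_coordFiber {i : ι} {X : Set (ι → ℝ)} {x : ι → ℝ} (hx : x ∈ X) :
    x i ∈ coordFiber i X x := by
  simpa using hx

lemma coordFiber_add_subset (i : ι) (X Y : Set (ι → ℝ)) (x y : ι → ℝ) :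
    coordFiber i X x + coordFiber i Y y ⊆ coordFiber i (X + Y) (x + y) := by
  rintro _ ⟨s, hs, t, ht, rfl⟩
  have : Function.update (x + y) i (s + t) = Function.update x i s + Function.update y i t := by
    ext j
    by_cases h : j = i
    · subst h; simp
    · simp [h]
  rw [mem_coordFiber, this]
  exact Set.add_mem_add hs ht

lemma IsCompact.coordFiber {i : ι} {X : Set (ι → ℝ)} (hX : IsCompact X) (x : ι → ℝ) :
    IsCompact (coordFiber i X x) := by
  refine (hX.image (continuous_apply i)).of_isClosed_subset
    (hX.isClosed.preimage (by fun_prop)) ?_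
  intro t ht
  exact ⟨_, ht, by simp⟩

/-- The compression of `X` in the direction of the coordinate `i`: each nonempty fibre is replaced
by the segment `[0, ℓ]` with `ℓ` the length of the fibre. -/
def compress (i : ι) (X : Set (ι → ℝ)) : Set (ι → ℝ) :=
  {x | 0 ≤ x i ∧ (coordFiber i X x).Nonempty ∧
    ENNReal.ofReal (x i) ≤ volume (coordFiber i X x)}

lemma update_zero_mem_compress (i : ι) {X : Set (ι → ℝ)} {x : ι → ℝ} (hx : x ∈ X) :
    Function.update x i 0 ∈ compress i X := by
  refine ⟨by simp, ⟨x i, ?_⟩, by simp⟩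
  rw [coordFiber_update]
  exact self_mem_coordFiber hx

/-- Compression does not increase sumsets, because `|S| + |T| ≤ |S + T|` on the line. -/
lemma compress_add_subset (i : ι) {X Y : Set (ι → ℝ)} (hX : IsCompact X) (hY : IsCompact Y) :
    compress i X + compress i Y ⊆ compress i (X + Y) := by
  rintro _ ⟨x, ⟨hx0, hx1, hx2⟩, y, ⟨hy0, hy1, hy2⟩, rfl⟩
  refine ⟨add_nonneg hx0 hy0, (hx1.add hy1).mono (coordFiber_add_subset i X Y x y), ?_⟩
  change ENNReal.ofReal (x i + y i) ≤ _
  rw [ENNReal.ofReal_add hx0 hy0]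
  exact (add_le_add hx2 hy2).trans ((Real.volume_add_volume_le_volume_add (hX.coordFiber x)
    (hY.coordFiber y) hx1 hy1).trans (measure_mono (coordFiber_add_subset i X Y x y)))

lemma kFoldSumset_compress_subset (i : ι) {X : Set (ι → ℝ)} (hX : IsCompact X) {k : ℕ}
    (hk : 1 ≤ k) : kFoldSumset k (compress i X) ⊆ compress i (kFoldSumset k X) := by
  induction k, hk using Nat.le_induction with
  | base => rw [kFoldSumset_one, kFoldSumset_one]
  | succ k hk ih =>
    rw [kFoldSumset_succ, kFoldSumset_succ]
    exact (Set.add_subset_add_right ih).trans (compress_add_subset i (hX.kFoldSumset k) hX)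

/-- The length of the fibres of a compact set is upper semicontinuous. -/
lemma limsup_volume_coordFiber_le (i : ι) {X : Set (ι → ℝ)} (hX : IsCompact X)
    {u : ℕ → ι → ℝ} {x : ι → ℝ} (hu : Tendsto u atTop (𝓝 x)) :
    limsup (fun n => volume (coordFiber i X (u n))) atTop ≤ volume (coordFiber i X x) := by
  have hK : IsCompact ((fun y : ι → ℝ => y i) '' X) := hX.image (continuous_apply i)
  set K := (fun y : ι → ℝ => y i) '' X
  have hm : ∀ y, MeasurableSet (coordFiber i X y) := fun y => (hX.coordFiber y).measurableSet
  have h := limsup_lintegral_le (μ := volume)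
    (f := fun n => (coordFiber i X (u n)).indicator fun _ => (1 : ℝ≥0∞))
    (K.indicator fun _ => (1 : ℝ≥0∞)) (fun n => measurable_const.indicator (hm _))
    (fun n => Eventually.of_forall fun t => by
      apply Set.indicator_le_indicator_of_subset
      · intro t ht; exact ⟨_, ht, by simp⟩
      · simp)
    (by
      rw [lintegral_indicator_const hK.measurableSet]
      simpa using hK.measure_lt_top.ne)
  simp only [lintegral_indicator_const (hm _), one_mul] at h
  refine h.trans ?_
  calc _ ≤ ∫⁻ t, (coordFiber i X x).indicator (fun _ => (1 : ℝ≥0∞)) t := by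
        apply lintegral_mono
        intro t
        by_cases ht : t ∈ coordFiber i X x
        · simp only [ht, Set.indicator_of_mem]
          refine limsup_le_of_le (by isBoundedDefault) (Eventually.of_forall fun n => ?_)
          exact Set.indicator_le_self' (by simp) _
        · have hev : ∀ᶠ n in atTop, t ∉ coordFiber i X (u n) := by
            have hc : Tendsto (fun n => Function.update (u n) i t) atTop
                (𝓝 (Function.update x i t)) := hu.update i tendsto_const_nhds
            exact hc.eventually (hX.isClosed.isOpen_compl.mem_nhds ht)
          have : (fun n => (coordFiber i X (u n)).indicator (fun _ => (1 : ℝ≥0∞)) t)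
              =ᶠ[atTop] fun _ => 0 := hev.mono fun n hn => by simp only [hn, not_false_iff,
                Set.indicator_of_notMem]
          change limsup _ _ ≤ _
          rw [limsup_congr this]
          simp
    _ = _ := by rw [lintegral_indicator_const (hm _), one_mul]

lemma IsCompact.compress [Finite ι] (i : ι) {X : Set (ι → ℝ)} (hX : IsCompact X) :
    IsCompact (compress i X) := by
  have hK : IsCompact ((fun y : ι → ℝ => y i) '' X) := hX.image (continuous_apply i)
  have hKf := hK.measure_lt_top (μ := volume)
  set K := (fun y : ι → ℝ => y i) '' X
  have hsub : ∀ y, _root_.coordFiber i X y ⊆ K := fun y t ht => ⟨_, ht, by simp⟩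
  -- The projection of `X` along `i`, times a segment, is a compact set containing the compression.
  have hC : IsCompact ((fun p : ℝ × (ι → ℝ) => Function.update p.2 i p.1) ''
      (Set.Icc 0 (volume K).toReal ×ˢ X)) :=
    (isCompact_Icc.prod hX).image (by fun_prop)
  have hsubset : _root_.compress i X ⊆ (fun p : ℝ × (ι → ℝ) => Function.update p.2 i p.1) ''
      (Set.Icc 0 (volume K).toReal ×ˢ X) := by
    rintro x ⟨h0, ⟨t, ht⟩, h2⟩
    refine ⟨(x i, Function.update x i t), ⟨⟨h0, ?_⟩, ht⟩, by simp⟩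
    rw [← ENNReal.ofReal_le_iff_le_toReal hKf.ne]
    exact h2.trans (measure_mono (hsub x))
  refine hC.of_isClosed_subset ?_ hsubset
  apply IsSeqClosed.isClosed
  intro u x hu hux
  have hui : Tendsto (fun n => u n i) atTop (𝓝 (x i)) := (tendsto_pi_nhds.1 hux) i
  refine ⟨ge_of_tendsto' hui fun n => (hu n).1, ?_, ?_⟩
  · choose t ht using fun n => (hu n).2.1
    obtain ⟨s, -, φ, hφ, hs⟩ := hK.tendsto_subseq fun n => hsub _ (ht n)
    refine ⟨s, hX.isClosed.mem_of_tendsto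
      ((hux.comp hφ.tendsto_atTop).update i hs) (Eventually.of_forall fun n => ht (φ n))⟩
  · refine le_trans ?_ (limsup_volume_coordFiber_le i hX hux)
    rw [← ((ENNReal.tendsto_ofReal hui).limsup_eq)]
    exact limsup_le_limsup (Eventually.of_forall fun n => (hu n).2.2)

lemma coordFiber_compress (i : ι) {X : Set (ι → ℝ)} (hX : IsCompact X) {x : ι → ℝ}
    (hx : (coordFiber i X x).Nonempty) :
    coordFiber i (compress i X) x = Set.Icc 0 (volume (coordFiber i X x)).toReal := by
  ext t
  simp [compress, coordFiber_update, hx,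
    ENNReal.ofReal_le_iff_le_toReal (hX.coordFiber x).measure_lt_top.ne]

lemma volume_coordFiber_compress (i : ι) {X : Set (ι → ℝ)} (hX : IsCompact X) (x : ι → ℝ) :
    volume (coordFiber i (compress i X) x) = volume (coordFiber i X x) := by
  rcases (coordFiber i X x).eq_empty_or_nonempty with h | h
  · rw [h, measure_empty]
    convert measure_empty (μ := volume)
    ext t
    simp [compress, coordFiber_update, h]
  · rw [coordFiber_compress i hX h, Real.volume_Icc, sub_zero,
      ENNReal.ofReal_toReal (hX.coordFiber x).measure_lt_top.ne]

variable [Fintype ι]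

/-- Tonelli's theorem in the form used below: fibrewise comparison of measures. -/
lemma volume_add_le_of_coordFiber (i : ι) {X Y Z : Set (ι → ℝ)} (hX : MeasurableSet X)
    (hY : MeasurableSet Y) (hZ : MeasurableSet Z)
    (h : ∀ x, volume (coordFiber i X x) + volume (coordFiber i Y x) ≤ volume (coordFiber i Z x)) :
    volume X + volume Y ≤ volume Z := by
  have key : ∀ W : Set (ι → ℝ), MeasurableSet W → ∀ x,
      ∫⁻ t, W.indicator (fun _ => (1 : ℝ≥0∞)) (Function.update x i t)
        = volume (coordFiber i W x) := by
    intro W hW x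
    exact lintegral_indicator_one (hW.preimage (measurable_update x))
  have hmeas : ∀ {W : Set (ι → ℝ)}, MeasurableSet W →
      Measurable (W.indicator fun _ => (1 : ℝ≥0∞)) := fun hW => measurable_const.indicator hW
  have h2 := lintegral_le_of_lmarginal_le (μ := fun _ : ι => (volume : Measure ℝ)) {i}
    ((hmeas hX).add (hmeas hY)) (hmeas hZ) (by
      rw [lmarginal_singleton, lmarginal_singleton]
      intro x
      simp only [Pi.add_apply]
      have hXx : Measurable fun t => X.indicator (fun _ => (1 : ℝ≥0∞)) (Function.update x i t) :=
        (hmeas hX).comp (measurable_update x)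
      rw [lintegral_add_left hXx, key X hX, key Y hY, key Z hZ]
      exact h x)
  simp only [Pi.add_apply] at h2
  rw [lintegral_add_left (hmeas hX), ← volume_pi, lintegral_indicator_const hX,
    lintegral_indicator_const hY, lintegral_indicator_const hZ] at h2
  simpa using h2

lemma volume_le_of_coordFiber (i : ι) {X Z : Set (ι → ℝ)} (hX : MeasurableSet X)
    (hZ : MeasurableSet Z)
    (h : ∀ x, volume (coordFiber i X x) ≤ volume (coordFiber i Z x)) :
    volume X ≤ volume Z := by
  simpa using volume_add_le_of_coordFiber i hX MeasurableSet.empty hZ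
    (fun x => by simpa [coordFiber] using h x)

lemma volume_compress (i : ι) {X : Set (ι → ℝ)} (hX : IsCompact X) :
    volume (compress i X) = volume X :=
  le_antisymm
    (volume_le_of_coordFiber i (hX.compress i).measurableSet hX.measurableSet
      fun x => (volume_coordFiber_compress i hX x).le)
    (volume_le_of_coordFiber i hX.measurableSet (hX.compress i).measurableSet
      fun x => (volume_coordFiber_compress i hX x).ge)

lemma volume_kFoldSumset_compress_le (i : ι) {X : Set (ι → ℝ)} (hX : IsCompact X) {k : ℕ}
    (hk : 1 ≤ k) : volume (kFoldSumset k (compress i X)) ≤ volume (kFoldSumset k X) :=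
  (measure_mono (kFoldSumset_compress_subset i hX hk)).trans
    (volume_compress i (hX.kFoldSumset k)).le

end Compression

/-! ### Sets with short fibres have large sumsets -/

section ShortFibres

variable {ι : Type*}

lemma pow_mul_volume_le_volume_kFoldSumset [Fintype ι] (k : ℕ) (A : Set (ι → ℝ)) :
    (k : ℝ≥0∞) ^ Fintype.card ι * volume A ≤ volume (kFoldSumset k A) := by
  calc (k : ℝ≥0∞) ^ Fintype.card ι * volume A = volume ((k : ℝ) • A) := by
        rw [Measure.addHaar_smul, Module.finrank_fintype_fun_eq_card, abs_of_nonneg (by positivity),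
          ENNReal.ofReal_pow (by positivity), ENNReal.ofReal_natCast]
    _ ≤ _ := by
        apply measure_mono
        rintro _ ⟨x, hx, rfl⟩
        have := nsmul_mem_kFoldSumset k hx
        simpa [← Nat.cast_smul_eq_nsmul ℝ] using this

variable [DecidableEq ι]

/-- If the fibres of `A` are shorter than `L / k`, then for `j ≤ k` the `j`-fold sums of the
compression of `A` do not wrap around modulo `L`, so that Raikov's inequality applies to them. -/
lemma ofReal_le_volume_image_of_mem_kFoldSumset_compress (i : ι) {A : Set (ι → ℝ)}
    (hA : IsCompact A) {k : ℕ} {L : ℝ} [hL : Fact (0 < L)]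
    (hdiam : ∀ x, ∀ s ∈ coordFiber i A x, ∀ t ∈ coordFiber i A x, t - s ≤ L)
    (hshort : ∀ x, volume (coordFiber i A x) ≤ ENNReal.ofReal (L / k)) {j : ℕ} (hj : 1 ≤ j)
    (hjk : j ≤ k) {x : ι → ℝ} (hx : x ∈ kFoldSumset j (compress i A)) :
    0 ≤ x i ∧ x i ≤ j * (L / k) ∧ (coordFiber i (kFoldSumset j A) x).Nonempty ∧
      ENNReal.ofReal (x i) ≤
        volume ((fun t : ℝ => (t : AddCircle L)) '' coordFiber i (kFoldSumset j A) x) := by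
  have hL0 := hL.out
  have base : ∀ y ∈ compress i A, ENNReal.ofReal (y i) ≤
      volume ((fun t : ℝ => (t : AddCircle L)) '' coordFiber i A y) := by
    rintro y ⟨-, hy1, hy2⟩
    obtain ⟨a, ha, ha'⟩ := (hA.coordFiber (i := i) y).exists_isLeast hy1
    refine hy2.trans (AddCircle.volume_le_volume_image_coe (a := a)
      (hA.coordFiber y).measurableSet fun t ht => ⟨ha' ht, ?_⟩)
    linarith [hdiam y a ha t ht]
  have base' : ∀ y ∈ compress i A, y i ≤ L / k := by
    rintro y ⟨-, -, hy2⟩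
    exact (ENNReal.ofReal_le_ofReal_iff (by positivity)).1 (hy2.trans (hshort y))
  induction j, hj using Nat.le_induction generalizing x with
  | base =>
    rw [kFoldSumset_one] at hx ⊢
    exact ⟨hx.1, by simpa using base' x hx, hx.2.1, base x hx⟩
  | succ j hj ih =>
    rw [kFoldSumset_succ] at hx ⊢
    obtain ⟨y, hy, z, hz, rfl⟩ := hx
    obtain ⟨h0, h1, h2, h3⟩ := ih (by omega) hy
    have hz' := base' z hz
    have hsub := coordFiber_add_subset i (kFoldSumset j A) A y z
    have hbound : y i + z i ≤ (j + 1 : ℕ) * (L / k) := by push_cast; linarith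
    refine ⟨add_nonneg h0 hz.1, hbound, (h2.add hz.2.1).mono hsub, ?_⟩
    have hle : y i + z i ≤ L := by
      refine hbound.trans ?_
      have hk0 : (0 : ℝ) < k := by exact_mod_cast (by omega : 0 < k)
      have : ((j + 1 : ℕ) : ℝ) ≤ k := by exact_mod_cast hjk
      calc ((j + 1 : ℕ) : ℝ) * (L / k) ≤ k * (L / k) := by gcongr
        _ = L := by field_simp
    have hcont : Continuous fun t : ℝ => (t : AddCircle L) := AddCircle.continuous_mk' L
    have hR := AddCircle.min_le_volume_add (((hA.kFoldSumset j).coordFiber (i := i) y).image hcont)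
      ((hA.coordFiber (i := i) z).image hcont) (h2.image _) (hz.2.1.image _)
    calc ENNReal.ofReal (y i + z i)
        ≤ min (ENNReal.ofReal L) (volume ((fun t : ℝ => (t : AddCircle L)) ''
            coordFiber i (kFoldSumset j A) y) +
            volume ((fun t : ℝ => (t : AddCircle L)) '' coordFiber i A z)) := by
          apply le_min (ENNReal.ofReal_le_ofReal hle)
          rw [ENNReal.ofReal_add h0 hz.1]
          exact add_le_add h3 (base z hz)
      _ ≤ _ := hR
      _ ≤ _ := by
          apply measure_mono
          rintro _ ⟨_, ⟨s, hs, rfl⟩, _, ⟨t, ht, rfl⟩, rfl⟩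
          exact ⟨s + t, hsub (Set.add_mem_add hs ht), by simp⟩

variable [Fintype ι]

lemma volume_add_volume_le_volume_kFoldSumset_succ (i : ι) {A : Set (ι → ℝ)}
    (hA : IsCompact A) {k : ℕ} {L : ℝ} (hL : 0 < L) (h0 : 0 ∈ A) (hLA : Pi.single i L ∈ A)
    (hdiam : ∀ x, ∀ s ∈ coordFiber i A x, ∀ t ∈ coordFiber i A x, t - s ≤ L)
    (hshort : ∀ x, volume (coordFiber i A x) ≤ ENNReal.ofReal (L / k)) {j : ℕ}
    (hjk : j + 1 ≤ k) :
    volume (kFoldSumset j A) + volume (kFoldSumset (j + 1) (compress i A)) ≤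
      volume (kFoldSumset (j + 1) A) := by
  have : Fact (0 < L) := ⟨hL⟩
  refine volume_add_le_of_coordFiber i (hA.kFoldSumset _).measurableSet
    ((hA.compress i).kFoldSumset _).measurableSet (hA.kFoldSumset _).measurableSet fun x => ?_
  have hG := (hA.kFoldSumset j).coordFiber (i := i) x
  have hG' := (hA.kFoldSumset (j + 1)).coordFiber (i := i) x
  have hstep := AddCircle.volume_add_volume_image_coe_le (L := L) hG.measurableSet
    hG'.measurableSet hG.bddAbove
    (fun t ht => by
      rw [mem_coordFiber, kFoldSumset_succ]
      simpa using Set.add_mem_add (mem_coordFiber.1 ht) h0)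
    (fun t ht => by
      have e : Function.update x i (t + L) = Function.update x i t + Pi.single i L := by
        ext m
        by_cases h : m = i
        · subst h; simp
        · simp [h]
      rw [mem_coordFiber, kFoldSumset_succ, e]
      exact Set.add_mem_add (mem_coordFiber.1 ht) hLA)
  refine le_trans ?_ hstep
  gcongr
  set τ := volume ((fun t : ℝ => (t : AddCircle L)) '' coordFiber i (kFoldSumset (j + 1) A) x)
  have hτ : τ ≠ ∞ := measure_ne_top _ _
  calc volume (coordFiber i (kFoldSumset (j + 1) (compress i A)) x)
      ≤ volume (Set.Icc 0 τ.toReal) := by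
        apply measure_mono
        intro t ht
        obtain ⟨h1, -, -, h2⟩ := ofReal_le_volume_image_of_mem_kFoldSumset_compress i hA hdiam
          hshort (by omega) hjk ht
        rw [coordFiber_update] at h2
        simp only [Function.update_self] at h1 h2
        exact ⟨h1, (ENNReal.ofReal_le_iff_le_toReal hτ).1 h2⟩
    _ = τ := by simp [hτ]

/-- A set whose fibres along a coordinate are short in comparison with its longest chord `[0, L e]` in
that direction has `k`-fold sumset at least as large as that of a convex body with a distant point.
The increments satisfy `|(j + 1)A| - |jA| ≥ |(j + 1)A*|`, and `(j + 1)A*` contains a dilate of `A*`. -/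
lemma sum_pow_mul_volume_le_of_short_fibres (i : ι) {A : Set (ι → ℝ)}
    (hA : IsCompact A) {k : ℕ} (hk : 1 ≤ k) {L : ℝ} (hL : 0 < L) (h0 : 0 ∈ A)
    (hLA : Pi.single i L ∈ A)
    (hdiam : ∀ x, ∀ s ∈ coordFiber i A x, ∀ t ∈ coordFiber i A x, t - s ≤ L)
    (hshort : ∀ x, volume (coordFiber i A x) ≤ ENNReal.ofReal (L / k)) :
    (∑ j ∈ Finset.Icc 1 k, (j : ℝ≥0∞) ^ Fintype.card ι) * volume A ≤ volume (kFoldSumset k A) := by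
  suffices ∀ j, 1 ≤ j → j ≤ k →
      (∑ m ∈ Finset.Icc 1 j, (m : ℝ≥0∞) ^ Fintype.card ι) * volume A ≤ volume (kFoldSumset j A) from
    this k hk le_rfl
  intro j hj
  induction j, hj using Nat.le_induction with
  | base => intro _; simp [kFoldSumset_one]
  | succ j hj ih =>
    intro hjk
    rw [Finset.sum_Icc_succ_top (by omega), add_mul]
    refine le_trans (add_le_add (ih (by omega)) ?_)
      (volume_add_volume_le_volume_kFoldSumset_succ i hA hL h0 hLA hdiam hshort hjk)
    rw [← volume_compress i hA]
    exact pow_mul_volume_le_volume_kFoldSumset _ _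

/-- A compact set with small `k`-fold sumset that contains a chord of length one in the direction
of a coordinate has a fibre in that direction of length more than `1 / k`: translate the set so that
its longest chord in that direction starts at the origin. -/
lemma exists_long_coordFiber (i : ι) {A : Set (ι → ℝ)} (hA : IsCompact A) {k : ℕ} (hk : 1 ≤ k)
    (h0 : 0 ∈ A) (h1 : Pi.single i 1 ∈ A)
    (hsmall : volume (kFoldSumset k A) <
      (∑ j ∈ Finset.Icc 1 k, (j : ℝ≥0∞) ^ Fintype.card ι) * volume A) :
    ∃ x, ENNReal.ofReal (1 / k) < volume (coordFiber i A x) := by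
  by_contra! hcon
  have hP : IsCompact ((A ×ˢ A) ∩ {p | Function.update p.1 i (p.2 i) = p.2}) :=
    (hA.prod hA).inter_right (isClosed_eq (by fun_prop) (by fun_prop))
  obtain ⟨⟨a, b⟩, ⟨⟨haA, hbA⟩, hab⟩, hmax⟩ := hP.exists_isMaxOn
    ⟨(0, Pi.single i 1), ⟨h0, h1⟩, by simp [Pi.single]⟩
    (f := fun p : (ι → ℝ) × (ι → ℝ) => p.2 i - p.1 i) (by fun_prop)
  simp only [Set.mem_ofPred_eq] at haA hbA hab
  have hmax' : ∀ p ∈ A, ∀ q ∈ A, Function.update p i (q i) = q → q i - p i ≤ b i - a i :=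
    fun p hp q hq hpq => hmax (show (p, q) ∈ _ from ⟨⟨hp, hq⟩, hpq⟩)
  have hL1 : 1 ≤ b i - a i := by
    simpa using hmax' 0 h0 _ h1 (by simp [Pi.single])
  have hfib : ∀ x, coordFiber i ((fun y => y + (-a)) '' A) x
      = (fun t => t + a i) ⁻¹' coordFiber i A (x + a) := by
    intro x
    ext t
    have e : Function.update (x + a) i (t + a i) = Function.update x i t + a := by
      ext m
      by_cases h : m = i
      · subst h; simp
      · simp [h]
    simp only [mem_coordFiber, Set.mem_preimage, e, Set.image_add_right, neg_neg]
  refine hsmall.not_ge ?_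
  have hmain := sum_pow_mul_volume_le_of_short_fibres i (A := (fun y => y + (-a)) '' A)
    (hA.image (by fun_prop)) hk (L := b i - a i) (by linarith) ⟨a, haA, by simp⟩
    ⟨b, hbA, by
      ext m
      by_cases h : m = i
      · subst h; simp [sub_eq_add_neg]
      · have := congrFun hab m
        simp only [ne_eq, h, not_false_eq_true, Function.update_of_ne] at this
        simp [h, this]⟩
    (by
      intro x s hs t ht
      rw [hfib] at hs ht
      have := hmax' _ hs _ ht (by simp)
      simpa using this)
    (by
      intro x
      rw [hfib, measure_preimage_add_right]
      refine (hcon _).trans (ENNReal.ofReal_le_ofReal ?_)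
      gcongr)
  rw [kFoldSumset_image_add_right] at hmain
  simpa [Set.image_add_right] using hmain

end ShortFibres

/-! ### Compressing along all coordinates -/

section Successive

variable {ι : Type*} [DecidableEq ι]

/-- `X` lies in the half-space `0 ≤ x i`, and each of its fibres in the direction of the coordinate
`i` is an initial segment of `[0, ∞)`. -/
def IsInitialAlong (i : ι) (X : Set (ι → ℝ)) : Prop :=
  ∀ x ∈ X, 0 ≤ x i ∧ ∀ s, 0 ≤ s → s ≤ x i → Function.update x i s ∈ X

lemma isInitialAlong_compress (i : ι) (X : Set (ι → ℝ)) : IsInitialAlong i (compress i X) := by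
  rintro x ⟨h0, h1, h2⟩
  refine ⟨h0, fun s hs hsx => ⟨by simpa using hs, ?_, ?_⟩⟩
  · rwa [coordFiber_update]
  · rw [coordFiber_update, Function.update_self]
    exact (ENNReal.ofReal_le_ofReal hsx).trans h2

lemma IsInitialAlong.compress {i j : ι} (hij : j ≠ i) {X : Set (ι → ℝ)} (h : IsInitialAlong j X) :
    IsInitialAlong j (compress i X) := by
  rintro x ⟨h0, ⟨t, ht⟩, h2⟩
  have hx0 : 0 ≤ x j := by simpa [hij] using (h _ ht).1
  refine ⟨hx0, fun s hs hsx => ?_⟩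
  have hsub : coordFiber i X x ⊆ coordFiber i X (Function.update x j s) := by
    intro u hu
    rw [mem_coordFiber, Function.update_comm hij]
    exact (h _ hu).2 s hs (by simpa [hij] using hsx)
  exact ⟨by simpa [hij.symm] using h0, ⟨t, hsub ht⟩,
    by simpa [hij.symm] using h2.trans (measure_mono hsub)⟩

variable [Fintype ι]

lemma mem_of_forall_isInitialAlong {X : Set (ι → ℝ)} (h : ∀ i, IsInitialAlong i X) {x y : ι → ℝ}
    (hx : x ∈ X) (hy0 : 0 ≤ y) (hyx : y ≤ x) : y ∈ X := by
  suffices ∀ s : Finset ι, s.piecewise y x ∈ X by simpa using this Finset.univ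
  intro s
  induction s using Finset.induction_on with
  | empty => simpa using hx
  | insert i s his ih =>
    rw [Finset.piecewise_insert]
    exact (h i _ ih).2 _ (hy0 i) (by simpa [his] using hyx i)

/-- Compressing a set with small `k`-fold sumset along all coordinates, one after the other, gives a
set of the same measure, still with small `k`-fold sumset, that reaches out at least `1 / k` in each
direction, because the set had a long fibre in that direction just before it was compressed. -/
lemma exists_compression {A : Set (ι → ℝ)} (hA : IsCompact A) {k : ℕ} (hk : 1 ≤ k)
    (h0 : 0 ∈ A) (h1 : ∀ i, Pi.single i 1 ∈ A) (hbdd : ∀ x ∈ A, ∀ i, |x i| ≤ 1)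
    (hsmall : volume (kFoldSumset k A) <
      (∑ j ∈ Finset.Icc 1 k, (j : ℝ≥0∞) ^ Fintype.card ι) * volume A) :
    ∃ D : Set (ι → ℝ), volume D = volume A ∧
      volume (kFoldSumset k D) ≤ volume (kFoldSumset k A) ∧
      (∀ i, IsInitialAlong i D) ∧ (∀ i, ∀ x ∈ D, x i ≤ 2) ∧ ∀ i, ∃ y ∈ D, 1 / (k : ℝ) ≤ y i := by
  suffices ∀ s : Finset ι, ∃ D : Set (ι → ℝ), IsCompact D ∧ volume D = volume A ∧
      volume (kFoldSumset k D) ≤ volume (kFoldSumset k A) ∧ 0 ∈ D ∧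
      (∀ i ∉ s, Pi.single i 1 ∈ D ∧ ∀ x ∈ D, |x i| ≤ 1) ∧
      ∀ i ∈ s, IsInitialAlong i D ∧ (∀ x ∈ D, x i ≤ 2) ∧ ∃ y ∈ D, 1 / (k : ℝ) ≤ y i by
    obtain ⟨D, -, hD1, hD2, -, -, hD⟩ := this Finset.univ
    exact ⟨D, hD1, hD2, fun i => (hD i (Finset.mem_univ i)).1,
      fun i => (hD i (Finset.mem_univ i)).2.1, fun i => (hD i (Finset.mem_univ i)).2.2⟩
  intro s
  induction s using Finset.induction_on with
  | empty => exact ⟨A, hA, rfl, le_rfl, h0, fun i _ => ⟨h1 i, fun x hx => hbdd x hx i⟩, by simp⟩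
  | insert i s his ih =>
    obtain ⟨D, hD, hvol, hsum, hD0, hDout, hDin⟩ := ih
    obtain ⟨z, hz⟩ := exists_long_coordFiber i hD hk hD0 (hDout i his).1 (by
      rw [hvol]; exact hsum.trans_lt hsmall)
    have hfib : ∀ x, coordFiber i D x ⊆ Set.Icc (-1) 1 := fun x t ht => by
      simpa [abs_le] using (hDout i his).2 _ ht
    refine ⟨compress i D, hD.compress i, (volume_compress i hD).trans hvol,
      (volume_kFoldSumset_compress_le i hD hk).trans hsum, ?_, ?_, ?_⟩
    · simpa using update_zero_mem_compress i hD0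
    · intro j hj
      obtain ⟨hji, hjs⟩ : j ≠ i ∧ j ∉ s := by simpa using hj
      constructor
      · convert update_zero_mem_compress i (hDout j hjs).1 using 1
        ext m
        by_cases h : m = i
        · subst h; simp [hji]
        · simp [h]
      · rintro x ⟨-, ⟨t, ht⟩, -⟩
        simpa [hji] using (hDout j hjs).2 _ ht
    · intro j hj
      by_cases hji : j = i
      · subst hji
        refine ⟨isInitialAlong_compress j D, ?_, ?_⟩
        · rintro x ⟨-, -, hx⟩
          have := hx.trans (measure_mono (hfib x))
          rw [Real.volume_Icc, ENNReal.ofReal_le_ofReal_iff (by norm_num)] at this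
          linarith
        · refine ⟨Function.update z j (1 / k), ⟨by simp, ?_, ?_⟩, by simp⟩
          · rw [coordFiber_update]
            exact nonempty_of_measure_ne_zero hz.ne_bot
          · rw [coordFiber_update, Function.update_self]
            exact hz.le
      · have hjs : j ∈ s := (Finset.mem_insert.1 hj).resolve_left hji
        obtain ⟨h1, h2, y, hy, hy'⟩ := hDin j hjs
        refine ⟨h1.compress hji, ?_, _, update_zero_mem_compress i hy, by simpa [hji] using hy'⟩
        rintro x ⟨-, ⟨t, ht⟩, -⟩
        simpa [hji] using h2 _ ht

end Successive

/-! ### Down-sets with small doubling -/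

section DownSet

/-- Down-sets of the orthant `[0, ∞)ⁿ`. -/
def IsOrthantDownSet {ι : Type*} (X : Set (ι → ℝ)) : Prop :=
  ∀ x ∈ X, 0 ≤ x ∧ ∀ y, 0 ≤ y → y ≤ x → y ∈ X

lemma volume_cons_prod {n : ℕ} (I : Set ℝ) (S : Set (Fin n → ℝ)) :
    volume {x : Fin (n + 1) → ℝ | x 0 ∈ I ∧ Fin.tail x ∈ S} = volume I * volume S := by
  have h := volume_preserving_piFinSuccAbove (fun _ : Fin (n + 1) => ℝ) 0
  rw [← Measure.prod_prod, ← Measure.volume_eq_prod, ← h.measure_preimage_equiv]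
  congr 1

lemma IsOrthantDownSet.section {n : ℕ} {X : Set (Fin (n + 1) → ℝ)} (h : IsOrthantDownSet X)
    (t : ℝ) : IsOrthantDownSet {y : Fin n → ℝ | (Fin.cons t y : Fin (n + 1) → ℝ) ∈ X} := by
  intro x hx
  have hx' := (h _ hx).1
  refine ⟨fun i => by simpa using hx' i.succ, fun y hy0 hyx => ?_⟩
  refine (h _ hx).2 _ (fun i => ?_) (fun i => ?_)
  · cases i using Fin.cases with
    | zero => simpa using hx' 0
    | succ i => simpa using hy0 i
  · cases i using Fin.cases with
    | zero => simp
    | succ i => simpa using hyx i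

lemma IsOrthantDownSet.cons_mem {n : ℕ} {X : Set (Fin (n + 1) → ℝ)} (h : IsOrthantDownSet X)
    {s t : ℝ} {y : Fin n → ℝ} (hy : (Fin.cons t y : Fin (n + 1) → ℝ) ∈ X) (hs : 0 ≤ s)
    (hst : s ≤ t) : (Fin.cons s y : Fin (n + 1) → ℝ) ∈ X := by
  have hx' := (h _ hy).1
  refine (h _ hy).2 _ (fun i => ?_) (fun i => ?_)
  · cases i using Fin.cases with
    | zero => simpa using hs
    | succ i => simpa using hx' i.succ
  · cases i using Fin.cases with
    | zero => simpa using hst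
    | succ i => simp

lemma cons_add_cons {n : ℕ} (s t : ℝ) (x y : Fin n → ℝ) :
    (Fin.cons s x + Fin.cons t y : Fin (n + 1) → ℝ) = Fin.cons (s + t) (x + y) := by
  ext i
  cases i using Fin.cases with
  | zero => simp
  | succ i => simp

/-- A down-set `B` of positive measure whose sumset with a down-set `A` reaching out to `r` in each
coordinate direction is comparable to `B` cannot be small. The proof is by induction on the
dimension: writing `A₀`, `B₀` for the sections at height `0` and `B_c` for the section at
height `c = r / 2K`, the sets `[0, r] × B₀` and `[0, c] × (A₀ + B_c)` are in `A + B`; the first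
inclusion shows that `B_c` carries a positive proportion of `B`, and by the second the pair
`A₀`, `B_c` satisfies the assumption one dimension lower. -/
lemma exists_le_volume_of_isOrthantDownSet (n : ℕ) {r R : ℝ} (hr : 0 < r) (hR : 0 < R) :
    ∀ K : ℝ, 0 < K → ∃ c : ℝ, 0 < c ∧ ∀ A B : Set (Fin n → ℝ), IsOrthantDownSet A →
      IsOrthantDownSet B → (∀ i, Pi.single i r ∈ A) → (∀ x ∈ B, ∀ i, x i ≤ R) → volume B ≠ 0 →
      volume (A + B) ≤ ENNReal.ofReal K * volume B → ENNReal.ofReal c ≤ volume B := by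
  induction n with
  | zero =>
    refine fun K hK => ⟨1, one_pos, fun A B _ _ _ _ hB0 _ => ?_⟩
    obtain ⟨x, hx⟩ := nonempty_of_measure_ne_zero hB0
    have : B = Set.univ := Set.eq_univ_of_forall fun y => by rwa [Subsingleton.elim y x]
    rw [this, volume_pi, Measure.pi_of_empty]
    simp
  | succ n ih =>
    intro K hK
    set c := r / (2 * K) with hc
    have hc0 : 0 < c := by positivity
    obtain ⟨δ, hδ, hind⟩ := ih (2 * K * R / c) (by positivity)
    refine ⟨c * δ, by positivity, fun A B hA hB hAr hBR hB0 hAB => ?_⟩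
    set A₀ : Set (Fin n → ℝ) := {y | (Fin.cons 0 y : Fin (n + 1) → ℝ) ∈ A}
    set B₀ : Set (Fin n → ℝ) := {y | (Fin.cons 0 y : Fin (n + 1) → ℝ) ∈ B} with hB₀
    set Bc : Set (Fin n → ℝ) := {y | (Fin.cons c y : Fin (n + 1) → ℝ) ∈ B} with hBc
    have fin_of_le : ∀ {m : ℕ} (S : Set (Fin m → ℝ)), (∀ x ∈ S, 0 ≤ x ∧ ∀ i, x i ≤ R) →
        volume S ≠ ∞ := by
      intro m S hS
      have hfin : volume (Set.Icc 0 fun _ : Fin m => R) < ∞ := isCompact_Icc.measure_lt_top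
      have hsub : S ⊆ Set.Icc 0 fun _ : Fin m => R := fun x hx => ⟨(hS x hx).1, (hS x hx).2⟩
      exact ((measure_mono hsub).trans_lt hfin).ne
    have hBfin : volume B ≠ ∞ := fin_of_le B fun x hx => ⟨(hB x hx).1, hBR x hx⟩
    have hB₀fin : volume B₀ ≠ ∞ := fin_of_le B₀ fun x hx =>
      ⟨(hB.section 0 x hx).1, fun i => by simpa using hBR _ hx i.succ⟩
    have hBcfin : volume Bc ≠ ∞ := fin_of_le Bc fun x hx =>
      ⟨(hB.section c x hx).1, fun i => by simpa using hBR _ hx i.succ⟩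
    have hprod1 : ENNReal.ofReal r * volume B₀ ≤ volume (A + B) := by
      have := volume_cons_prod (Set.Icc 0 r) B₀
      rw [Real.volume_Icc, sub_zero] at this
      rw [← this]
      apply measure_mono
      rintro x ⟨⟨hx0, hxr⟩, hx⟩
      rw [← Fin.cons_self_tail x]
      have hsingle : (Fin.cons (x 0) 0 : Fin (n + 1) → ℝ) ∈ A := by
        refine hA.cons_mem (t := r) ?_ hx0 hxr
        convert hAr 0
        ext i
        cases i using Fin.cases with
        | zero => simp
        | succ i => simp
      have := Set.add_mem_add hsingle hx
      rwa [cons_add_cons, add_zero, zero_add] at this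
    have hprod2 : ENNReal.ofReal c * volume (A₀ + Bc) ≤ volume (A + B) := by
      have := volume_cons_prod (Set.Icc 0 c) (A₀ + Bc)
      rw [Real.volume_Icc, sub_zero] at this
      rw [← this]
      apply measure_mono
      rintro x ⟨⟨hx0, hxc⟩, a, ha, b, hb, hab⟩
      rw [← Fin.cons_self_tail x, ← hab]
      have := Set.add_mem_add (s := A) (t := B) ha (hB.cons_mem hb hx0 hxc)
      rwa [cons_add_cons, zero_add] at this
    have hprod3 : ENNReal.ofReal c * volume Bc ≤ volume B := by
      have := volume_cons_prod (Set.Icc 0 c) Bc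
      rw [Real.volume_Icc, sub_zero] at this
      rw [← this]
      apply measure_mono
      rintro x ⟨⟨hx0, hxc⟩, hx⟩
      rw [← Fin.cons_self_tail x]
      exact hB.cons_mem hx hx0 hxc
    have hcover : volume B ≤ ENNReal.ofReal c * volume B₀ + ENNReal.ofReal R * volume Bc := by
      have h1 := volume_cons_prod (Set.Icc 0 c) B₀
      have h2 := volume_cons_prod (Set.Icc 0 R) Bc
      rw [Real.volume_Icc, sub_zero] at h1 h2
      rw [← h1, ← h2]
      refine (measure_mono fun x hx => ?_).trans (measure_union_le _ _)
      have hx0 : 0 ≤ x 0 := (hB x hx).1 0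
      have hx' := hx
      rw [← Fin.cons_self_tail x] at hx'
      rcases le_total (x 0) c with h | h
      · exact Or.inl ⟨⟨hx0, h⟩, hB.cons_mem hx' le_rfl hx0⟩
      · exact Or.inr ⟨⟨hx0, hBR x hx 0⟩, hB.cons_mem hx' hc0.le h⟩
    have key : volume B ≤ ENNReal.ofReal (2 * R) * volume Bc := by
      have h1 := hprod1.trans hAB
      rw [← ENNReal.ofReal_toReal hBfin, ← ENNReal.ofReal_toReal hB₀fin,
        ← ENNReal.ofReal_mul hr.le, ← ENNReal.ofReal_mul hK.le,
        ENNReal.ofReal_le_ofReal_iff (by positivity)] at h1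
      rw [← ENNReal.ofReal_toReal hBfin, ← ENNReal.ofReal_toReal hB₀fin,
        ← ENNReal.ofReal_toReal hBcfin, ← ENNReal.ofReal_mul hc0.le, ← ENNReal.ofReal_mul hR.le,
        ← ENNReal.ofReal_add (by positivity) (by positivity),
        ENNReal.ofReal_le_ofReal_iff (by positivity)] at hcover
      rw [← ENNReal.ofReal_toReal hBfin, ← ENNReal.ofReal_toReal hBcfin,
        ← ENNReal.ofReal_mul (by positivity), ENNReal.ofReal_le_ofReal_iff (by positivity)]
      have h2 : c * (volume B₀).toReal ≤ (volume B).toReal / 2 := by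
        rw [hc, div_mul_eq_mul_div, div_le_iff₀ (by positivity)]
        linarith
      linarith
    have hBc0 : volume Bc ≠ 0 := by
      intro h
      rw [h, mul_zero] at key
      exact hB0 (le_antisymm key bot_le)
    have hsmall : volume (A₀ + Bc) ≤ ENNReal.ofReal (2 * K * R / c) * volume Bc := by
      have hcne : ENNReal.ofReal c ≠ 0 := by simpa using hc0
      rw [← ENNReal.mul_le_mul_iff_right hcne ENNReal.ofReal_ne_top]
      calc ENNReal.ofReal c * volume (A₀ + Bc) ≤ ENNReal.ofReal K * volume B := hprod2.trans hAB
        _ ≤ ENNReal.ofReal K * (ENNReal.ofReal (2 * R) * volume Bc) := by gcongr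
        _ = ENNReal.ofReal c * (ENNReal.ofReal (2 * K * R / c) * volume Bc) := by
          rw [← mul_assoc, ← mul_assoc, ← ENNReal.ofReal_mul hK.le, ← ENNReal.ofReal_mul hc0.le]
          congr 2
          field_simp
    have := hind A₀ Bc (hA.section 0) (hB.section c)
      (fun i => by
        change (Fin.cons 0 (Pi.single i r) : Fin (n + 1) → ℝ) ∈ A
        convert hAr i.succ
        ext j
        cases j using Fin.cases with
        | zero => simp
        | succ j => simp [Pi.single_apply])
      (fun x hx i => by simpa using hBR _ hx i.succ) hBc0 hsmall
    rw [ENNReal.ofReal_mul hc0.le]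
    refine le_trans ?_ hprod3
    gcongr

end DownSet

/-! ### Normalisation of compact sets -/

section Normalisation

variable {ι : Type*} [Fintype ι]

lemma span_sub_eq_top_of_volume_ne_zero {A : Set (ι → ℝ)} (hA : volume A ≠ 0) (a : ι → ℝ) :
    Submodule.span ℝ ((fun x => x - a) '' A) = ⊤ := by
  by_contra h
  refine hA (measure_mono_null (fun x hx => ?_)
    ((measure_preimage_add_right volume (-a) (Submodule.span ℝ ((fun x => x - a) '' A) :
      Set (ι → ℝ))).trans (Measure.addHaar_submodule volume _ h)))
  exact Submodule.subset_span ⟨x, hx, sub_eq_add_neg x a⟩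

variable [DecidableEq ι]

/-- A compact set of positive measure is the image, under an affine isomorphism, of a set in the
cube `[-1, 1]ᵈ` that contains the origin and the standard basis vectors: those `d + 1` points go to
the vertices of a simplex of maximal volume with vertices in the set. -/
lemma exists_affine_normalisation {A : Set (ι → ℝ)} (hA : IsCompact A) (hA0 : volume A ≠ 0) :
    ∃ (f : (ι → ℝ) ≃ₗ[ℝ] (ι → ℝ)) (a : ι → ℝ), a ∈ A ∧ (∀ i, f (Pi.single i 1) + a ∈ A) ∧
      ∀ y, f y + a ∈ A → ∀ i, |y i| ≤ 1 := by
  obtain ⟨a₀, ha₀⟩ := nonempty_of_measure_ne_zero hA0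
  let M : (ι → ℝ) × (ι → ι → ℝ) → Matrix ι ι ℝ := fun p => Matrix.of fun i j => p.2 j i - p.1 i
  have hMc : Continuous fun p => |(M p).det| := by
    apply Continuous.abs
    apply Continuous.matrix_det
    exact continuous_matrix fun i j => by simp only [M, Matrix.of_apply]; fun_prop
  obtain ⟨p₀, hp₀, hp₀M⟩ : ∃ p : ι → ι → ℝ, (∀ j, p j ∈ A) ∧ (M (a₀, p)).det ≠ 0 := by
    have hspan := span_sub_eq_top_of_volume_ne_zero hA0 a₀
    obtain ⟨v, hv, -, hv'⟩ := Submodule.exists_fun_fin_finrank_span_eq ℝ ((fun x => x - a₀) '' A)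
    have hcard : Module.finrank ℝ (Submodule.span ℝ ((fun x => x - a₀) '' A)) = Fintype.card ι := by
      rw [hspan, finrank_top, Module.finrank_fintype_fun_eq_card]
    let e : ι ≃ Fin _ := (Fintype.equivFinOfCardEq hcard.symm)
    choose q hq hqv using hv
    refine ⟨fun j => q (e j), fun j => hq _, ?_⟩
    have hcol : (M (a₀, fun j => q (e j))).col = v ∘ e := by
      ext j i
      simp [M, Matrix.col, ← hqv]
    have := (Matrix.linearIndependent_cols_iff_isUnit (K := ℝ)).1
      (hcol ▸ hv'.comp e e.injective)
    exact ((Matrix.isUnit_iff_isUnit_det _).1 this).ne_zero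
  obtain ⟨⟨a, p⟩, ⟨ha, hp⟩, hmax⟩ := (hA.prod (isCompact_univ_pi fun _ : ι => hA)).exists_isMaxOn
    ⟨(a₀, p₀), ha₀, fun j _ => hp₀ j⟩ hMc.continuousOn
  have hp' : ∀ j, p j ∈ A := fun j => hp j (Set.mem_univ j)
  set N := M (a, p) with hN
  have hdet : 0 < |N.det| := (abs_pos.2 hp₀M).trans_le (hmax ⟨ha₀, fun j _ => hp₀ j⟩)
  have hunit : IsUnit N.det := (abs_pos.1 hdet).isUnit
  have hlin : LinearMap.det (Matrix.toLin' N) ≠ 0 := by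
    rw [LinearMap.det_toLin']; exact abs_pos.1 hdet
  refine ⟨LinearMap.equivOfDetNeZero _ hlin, a, ha, fun j => ?_, fun y hy i => ?_⟩
  · have : Matrix.toLin' N (Pi.single j 1) + a = p j := by
      ext i
      simp [N, M, Matrix.of_apply]
    change Matrix.toLin' N (Pi.single j 1) + a ∈ A
    rw [this]
    exact hp' j
  · change Matrix.toLin' N y + a ∈ A at hy
    rw [Matrix.toLin'_apply] at hy
    -- By Cramer's rule, `y i * det N` is the determinant for the simplex in which the vertex `p i`
    -- is replaced by the point `N y + a` of `A`.
    have hcr : N.det * y i = (M (a, Function.update p i (N.mulVec y + a))).det := by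
      have h1 : N.cramer (N.mulVec y) = N.det • y := by
        rw [Matrix.cramer_eq_adjugate_mulVec, Matrix.mulVec_mulVec, Matrix.adjugate_mul,
          Matrix.smul_mulVec, Matrix.one_mulVec]
      have h2 := congrFun h1 i
      rw [Matrix.cramer_apply, Pi.smul_apply, smul_eq_mul] at h2
      rw [← h2]
      congr 1
      ext r s
      by_cases h : s = i
      · subst h; simp [M]
      · simp [M, N, h]
    have hle : |N.det * y i| ≤ |N.det| := by
      rw [hcr]
      refine hmax ⟨ha, fun j _ => ?_⟩
      by_cases h : j = i
      · subst h; simpa using hy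
      · simpa [h] using hp' j
    rw [abs_mul] at hle
    exact le_of_mul_le_mul_left (by simpa using hle) hdet

end Normalisation

/-! ### The upper bound for the convex hull -/

section UpperBound

lemma exists_le_volume_of_normalised (d : ℕ) {k : ℕ} (hk : 1 ≤ k) :
    ∃ c : ℝ, 0 < c ∧ ∀ A : Set (Fin d → ℝ), IsCompact A → 0 ∈ A → (∀ i, Pi.single i 1 ∈ A) →
      (∀ x ∈ A, ∀ i, |x i| ≤ 1) →
      volume (kFoldSumset k A) < (∑ j ∈ Finset.Icc 1 k, (j : ℝ≥0∞) ^ d) * volume A →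
      ENNReal.ofReal c ≤ volume A := by
  have hk0 : (0 : ℝ) < k := by exact_mod_cast hk
  set K : ℝ := ∑ j ∈ Finset.Icc 1 k, (j : ℝ) ^ d with hK
  have hK0 : 0 < K := Finset.sum_pos (fun j hj => by
    have : 0 < (j : ℝ) := by exact_mod_cast (Finset.mem_Icc.1 hj).1
    positivity) ⟨1, by simpa using hk⟩
  have hKsum : ENNReal.ofReal K = ∑ j ∈ Finset.Icc 1 k, (j : ℝ≥0∞) ^ d := by
    rw [hK, ENNReal.ofReal_sum_of_nonneg fun j _ => by positivity]
    exact Finset.sum_congr rfl fun j _ => by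
      rw [ENNReal.ofReal_pow (by positivity), ENNReal.ofReal_natCast]
  obtain ⟨c, hc, H⟩ := exists_le_volume_of_isOrthantDownSet d (r := 1 / k) (R := 2)
    (by positivity) two_pos K hK0
  refine ⟨c, hc, fun A hA h0 h1 hbdd hsmall => ?_⟩
  have hk2 : 2 ≤ k := by
    by_contra hlt
    obtain rfl : k = 1 := by omega
    simp [kFoldSumset_one] at hsmall
  obtain ⟨D, hvol, hsum, hdown, hD2, hDk⟩ := exists_compression hA hk h0 h1 hbdd
    (by simpa using hsmall)
  have hD : IsOrthantDownSet D := fun x hx =>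
    ⟨fun i => (hdown i x hx).1, fun y hy0 hyx => mem_of_forall_isInitialAlong hdown hx hy0 hyx⟩
  have hDvol : volume D ≠ 0 := by
    rw [hvol]
    rintro h
    simp [h] at hsmall
  have hD0 : 0 ∈ D := by
    obtain ⟨x, hx⟩ := nonempty_of_measure_ne_zero hDvol
    exact (hD x hx).2 0 le_rfl (hD x hx).1
  have hDD := add_self_subset_kFoldSumset hD0 hk2
  rw [← hvol]
  refine H D D hD hD (fun i => ?_) (fun x hx i => hD2 i x hx) hDvol ?_
  · obtain ⟨y, hy, hyk⟩ := hDk i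
    refine (hD y hy).2 _ (Pi.single_nonneg.2 (by positivity)) fun j => ?_
    by_cases h : j = i
    · subst h; simpa using hyk
    · simpa [h] using (hD y hy).1 j
  · rw [hKsum, hvol]
    exact (measure_mono hDD).trans (hsum.trans hsmall.le)

lemma exists_volume_convexHull_le_of_isCompact (d : ℕ) {k : ℕ} (hk : 1 ≤ k) :
    ∃ C : ℝ, 0 < C ∧ ∀ A : Set (Fin d → ℝ), IsCompact A →
      volume (kFoldSumset k A) < (∑ j ∈ Finset.Icc 1 k, (j : ℝ≥0∞) ^ d) * volume A →
      volume (convexHull ℝ A) ≤ ENNReal.ofReal C * volume A := by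
  obtain ⟨c, hc, H⟩ := exists_le_volume_of_normalised d hk
  refine ⟨2 ^ d / c, by positivity, fun A hA hsmall => ?_⟩
  have hA0 : volume A ≠ 0 := by
    rintro h
    simp [h] at hsmall
  obtain ⟨f, a, ha, hfa, hbdd⟩ := exists_affine_normalisation hA hA0
  set B : Set (Fin d → ℝ) := {y | f y + a ∈ A}
  have hfc : Continuous f := f.toLinearMap.continuous_of_finiteDimensional
  have hcube : B ⊆ Set.Icc (-1) 1 := fun y hy =>
    ⟨fun i => (abs_le.1 (hbdd y hy i)).1, fun i => (abs_le.1 (hbdd y hy i)).2⟩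
  have hBc : IsCompact B := isCompact_Icc.of_isClosed_subset
    (hA.isClosed.preimage (hfc.add continuous_const)) hcube
  have hAB : A = (fun x => x + a) '' (f '' B) := by
    ext x
    constructor
    · intro hx
      exact ⟨x - a, ⟨f.symm (x - a), by simpa [B] using hx, by simp⟩, by simp⟩
    · rintro ⟨_, ⟨y, hy, rfl⟩, rfl⟩
      exact hy
  set δ := ENNReal.ofReal |LinearMap.det (f : (Fin d → ℝ) →ₗ[ℝ] (Fin d → ℝ))|
  have hδ : δ ≠ 0 := by
    simpa [δ] using f.isUnit_det'.ne_zero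
  have hscale : ∀ (S : Set (Fin d → ℝ)) (b : Fin d → ℝ),
      volume ((fun x => x + b) '' (f '' S)) = δ * volume S := by
    intro S b
    rw [Set.image_add_right, measure_preimage_add_right]
    exact Measure.addHaar_image_linearMap volume (f : (Fin d → ℝ) →ₗ[ℝ] (Fin d → ℝ)) S
  have hsum : volume (kFoldSumset k A) = δ * volume (kFoldSumset k B) := by
    rw [← hscale _ (k • a), hAB, kFoldSumset_image_add_right]
    congr 2
    exact kFoldSumset_image k f.toLinearMap.toAddMonoidHom B
  have hvol : volume A = δ * volume B := by rw [← hscale _ a, ← hAB]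
  have hB := H B hBc (by simpa [B] using ha) hfa hbdd (by
    rw [hsum, hvol, mul_left_comm] at hsmall
    exact lt_of_mul_lt_mul_left' hsmall)
  have hhull : convexHull ℝ A ⊆ (fun x => x + a) '' (f '' Set.Icc (-1) 1) := by
    apply convexHull_min
    · rw [hAB]
      exact Set.image_mono (Set.image_mono hcube)
    · simpa [Set.image_add_right] using
        (((convex_Icc (-1 : Fin d → ℝ) 1).linear_image f.toLinearMap).translate_preimage_left (-a))
  have hIcc : volume (Set.Icc (-1 : Fin d → ℝ) 1) = ENNReal.ofReal (2 ^ d) := by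
    rw [Real.volume_Icc_pi]
    simp only [Pi.one_apply, Pi.neg_apply, Finset.prod_const, Finset.card_univ, Fintype.card_fin]
    rw [← ENNReal.ofReal_pow (by norm_num)]
    norm_num
  calc volume (convexHull ℝ A) ≤ δ * ENNReal.ofReal (2 ^ d) := by
        rw [← hIcc, ← hscale _ a]
        exact measure_mono hhull
    _ = δ * (ENNReal.ofReal (2 ^ d / c) * ENNReal.ofReal c) := by
        rw [← ENNReal.ofReal_mul (p := 2 ^ d / c) (by positivity), div_mul_cancel₀ _ hc.ne']
    _ ≤ δ * (ENNReal.ofReal (2 ^ d / c) * volume B) := by gcongr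
    _ = _ := by rw [hvol, mul_left_comm]

/-- The measure of the convex hull is approximated by convex hulls of finite subsets. -/
lemma volume_convexHull_le_of_finite {d : ℕ} {A : Set (Fin d → ℝ)} {m : ℝ≥0∞}
    (h : ∀ F : Set (Fin d → ℝ), F.Finite → F ⊆ A → volume (convexHull ℝ F) ≤ m) :
    volume (convexHull ℝ A) ≤ m := by
  obtain ⟨T, hTA, hT, hAT⟩ :=
    (TopologicalSpace.IsSeparable.of_separableSpace A).exists_countable_dense_subset
  have hsub : convexHull ℝ A ⊆ closure (convexHull ℝ T) :=
    convexHull_min (hAT.trans (closure_mono (subset_convexHull ℝ T))) (convex_convexHull ℝ T).closure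
  have hfr := (convex_convexHull ℝ T).addHaar_frontier volume
  have hcl : volume (closure (convexHull ℝ T)) ≤ volume (convexHull ℝ T) := by
    rw [closure_eq_self_union_frontier]
    exact (measure_union_le _ _).trans (by rw [hfr, add_zero])
  refine (measure_mono hsub).trans (hcl.trans ?_)
  have : convexHull ℝ T = ⋃ F ∈ {F : Set (Fin d → ℝ) | F.Finite ∧ F ⊆ T}, convexHull ℝ F := by
    rw [convexHull_eq_union_convexHull_finite_subsets]
    ext x
    simp only [Set.mem_iUnion]
    constructor
    · rintro ⟨t, ht, hx⟩
      exact ⟨t, ⟨t.finite_toSet, ht⟩, hx⟩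
    · rintro ⟨F, ⟨hF, hFT⟩, hx⟩
      exact ⟨hF.toFinset, by simpa using hFT, by simpa using hx⟩
  rw [this, measure_biUnion_eq_iSup (Set.countable_ofPred_finite_subset hT)]
  · exact iSup₂_le fun F hF => h F hF.1 (hF.2.trans hTA)
  · rintro F ⟨hF, hFT⟩ G ⟨hG, hGT⟩
    exact ⟨F ∪ G, ⟨hF.union hG, Set.union_subset hFT hGT⟩, convexHull_mono Set.subset_union_left,
      convexHull_mono Set.subset_union_right⟩

lemma exists_volume_convexHull_le (d : ℕ) {k : ℕ} (hk : 1 ≤ k) :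
    ∃ C : ℝ, 0 < C ∧ ∀ A : Set (Fin d → ℝ), NullMeasurableSet A volume →
      volume (kFoldSumset k A) < (∑ j ∈ Finset.Icc 1 k, (j : ℝ≥0∞) ^ d) * volume A →
      volume (convexHull ℝ A) ≤ ENNReal.ofReal C * volume A := by
  obtain ⟨C, hC, H⟩ := exists_volume_convexHull_le_of_isCompact d hk
  refine ⟨C, hC, fun A hA hsmall => volume_convexHull_le_of_finite fun F hF hFA => ?_⟩
  set S := ∑ j ∈ Finset.Icc 1 k, (j : ℝ≥0∞) ^ d
  have hStop : S ≠ ∞ := by simp [S]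
  have hS0 : S ≠ 0 := by
    rintro h
    simp [h] at hsmall
  obtain ⟨A', hA'A, hA'm, hA'e⟩ := hA.exists_measurable_subset_ae_eq
  obtain ⟨Q, hQA', hQ, hQvol⟩ := hA'm.exists_lt_isCompact
    (r := volume (kFoldSumset k A) / S) (by
      rw [measure_congr hA'e]
      exact ENNReal.div_lt_of_lt_mul' hsmall)
  have hsub : Q ∪ F ⊆ A := Set.union_subset (hQA'.trans hA'A) hFA
  have hQsmall : volume (kFoldSumset k (Q ∪ F)) < S * volume (Q ∪ F) :=
    calc volume (kFoldSumset k (Q ∪ F)) ≤ volume (kFoldSumset k A) :=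
          measure_mono (kFoldSumset_mono k hsub)
      _ < S * volume Q := by
          rwa [ENNReal.div_lt_iff (Or.inl hS0) (Or.inl hStop), mul_comm] at hQvol
      _ ≤ S * volume (Q ∪ F) := by gcongr; exact Set.subset_union_left
  calc volume (convexHull ℝ F) ≤ volume (convexHull ℝ (Q ∪ F)) :=
        measure_mono (convexHull_mono Set.subset_union_right)
    _ ≤ ENNReal.ofReal C * volume (Q ∪ F) := H _ (hQ.union hF.isCompact) hQsmall
    _ ≤ _ := by gcongr

end UpperBound

/-! ### Sharpness: a cube and a distant point -/

section Sharpness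

variable {ι : Type*}

lemma kFoldSumset_cube_union_singleton (p : ι → ℝ) (k : ℕ) :
    kFoldSumset k (Set.Icc 0 1 ∪ {p}) =
      ⋃ j ∈ Finset.range (k + 1), (fun x => x + (k - j) • p) '' Set.Icc 0 (fun _ => (j : ℝ)) := by
  induction k with
  | zero =>
    have : (Set.Icc 0 fun _ : ι => (0 : ℝ)) = {0} := Set.Icc_self 0
    simp [kFoldSumset_zero, this]
  | succ k ih =>
    rw [kFoldSumset_succ, ih]
    ext x
    simp only [Set.mem_iUnion, Finset.mem_range, exists_prop]
    constructor
    · rintro ⟨y, hy, a, ha, rfl⟩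
      simp only [Set.mem_iUnion, exists_prop] at hy
      obtain ⟨j, hj, z, ⟨hz0, hz1⟩, rfl⟩ := hy
      rcases ha with ⟨ha0, ha1⟩ | rfl
      · refine ⟨j + 1, by omega, z + a, ⟨add_nonneg hz0 ha0, fun i => ?_⟩, ?_⟩
        · have h1 := hz1 i
          have h2 := ha1 i
          simp only [Pi.add_apply, Pi.one_apply, Nat.cast_add, Nat.cast_one] at *
          linarith
        · simp only [Nat.add_sub_add_right]
          abel
      · refine ⟨j, by omega, z, ⟨hz0, hz1⟩, ?_⟩
        have : k + 1 - j = (k - j) + 1 := by omega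
        simp only [this, succ_nsmul]
        abel
    · rintro ⟨j, hj, z, ⟨hz0, hz1⟩, rfl⟩
      rcases (Nat.lt_succ_iff.1 hj).eq_or_lt with rfl | hj'
      · have hk0 : (0 : ℝ) < (k + 1 : ℕ) := by positivity
        refine ⟨((k : ℝ) / (k + 1 : ℕ)) • z, ?_, ((1 : ℝ) / (k + 1 : ℕ)) • z, Or.inl ⟨?_, ?_⟩, ?_⟩
        · simp only [Set.mem_iUnion, exists_prop]
          refine ⟨k, by simp, ((k : ℝ) / (k + 1 : ℕ)) • z, ⟨?_, fun i => ?_⟩, by simp⟩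
          · exact smul_nonneg (by positivity) hz0
          · calc (k : ℝ) / (k + 1 : ℕ) * z i ≤ k / (k + 1 : ℕ) * (k + 1 : ℕ) := by
                  gcongr; exact hz1 i
              _ = k := by field_simp
        · exact smul_nonneg (by positivity) hz0
        · intro i
          calc (1 : ℝ) / (k + 1 : ℕ) * z i ≤ 1 / (k + 1 : ℕ) * (k + 1 : ℕ) := by
                gcongr; exact hz1 i
            _ = 1 := by field_simp
        · simp only [← add_smul, Nat.sub_self, zero_smul, add_zero]
          rw [← add_div]
          push_cast
          rw [div_self (by positivity), one_smul]
      · refine ⟨z + (k - j) • p, ?_, p, Or.inr rfl, ?_⟩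
        · simp only [Set.mem_iUnion, exists_prop]
          exact ⟨j, by omega, z, ⟨hz0, hz1⟩, rfl⟩
        · have : k + 1 - j = (k - j) + 1 := by omega
          simp only [this, succ_nsmul]
          abel

variable [Fintype ι] [DecidableEq ι]

lemma volume_kFoldSumset_cube_union_singleton (i₀ : ι) {k : ℕ} {N : ℝ} (hN : k < N) :
    volume (kFoldSumset k (Set.Icc 0 1 ∪ {Pi.single i₀ N} : Set (ι → ℝ))) =
      ∑ j ∈ Finset.Icc 1 k, (j : ℝ≥0∞) ^ Fintype.card ι := by
  have hpos : 0 < Fintype.card ι := Fintype.card_pos_iff.2 ⟨i₀⟩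
  rw [kFoldSumset_cube_union_singleton, measure_biUnion_finset]
  · have hterm : ∀ j ∈ Finset.range (k + 1), volume ((fun x => x + (k - j) • Pi.single i₀ N) ''
        Set.Icc (0 : ι → ℝ) fun _ => (j : ℝ)) = (j : ℝ≥0∞) ^ Fintype.card ι := by
      intro j _
      rw [Set.image_add_right, measure_preimage_add_right, Real.volume_Icc_pi]
      simp
    rw [Finset.sum_congr rfl hterm, Finset.range_eq_Ico, Finset.sum_eq_sum_Ico_succ_bot (by omega)]
    simp [hpos.ne', Finset.Ico_add_one_right_eq_Icc]
  · have hlt : ∀ i ∈ Finset.range (k + 1), ∀ j ∈ Finset.range (k + 1), i < j → Disjoint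
        ((fun x => x + (k - i) • Pi.single i₀ N) '' Set.Icc (0 : ι → ℝ) fun _ => (i : ℝ))
        ((fun x => x + (k - j) • Pi.single i₀ N) '' Set.Icc (0 : ι → ℝ) fun _ => (j : ℝ)) := by
      intro i hi j hj hij
      rw [Set.disjoint_left]
      rintro _ ⟨x, ⟨hx0, -⟩, rfl⟩ ⟨y, ⟨-, hy1⟩, hxy⟩
      have h := congrFun hxy i₀
      have hx := hx0 i₀
      have hy := hy1 i₀
      simp only [Finset.mem_range] at hi hj
      have hjk : (j : ℝ) ≤ k := by exact_mod_cast (by omega : j ≤ k)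
      have hle : ((k - j : ℕ) : ℝ) + 1 ≤ ((k - i : ℕ) : ℝ) := by
        exact_mod_cast (by omega : k - j + 1 ≤ k - i)
      have hN0 : 0 ≤ N := (Nat.cast_nonneg k).trans hN.le
      have := mul_le_mul_of_nonneg_right hle hN0
      simp only [Pi.add_apply, Pi.smul_apply, Pi.single_eq_same, Pi.zero_apply] at h hx hy
      rw [nsmul_eq_mul, nsmul_eq_mul] at h
      linarith
    intro i hi j hj hij
    rcases lt_or_gt_of_ne hij with h | h
    · exact hlt i hi j hj h
    · exact (hlt j hj i hi h).symm
  · intro j _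
    exact (isCompact_Icc.image (by fun_prop)).measurableSet

/-- The convex hull of the unit cube and `N e₀` contains a box of volume `N / 2ᵈ`. -/
lemma le_volume_convexHull_cube_union_singleton (i₀ : ι) {N : ℝ} (hN : 0 < N) :
    ENNReal.ofReal (N * (1 / 2) ^ Fintype.card ι) ≤
      volume (convexHull ℝ (Set.Icc 0 1 ∪ {Pi.single i₀ N} : Set (ι → ℝ))) := by
  have hbox : volume (Set.Icc (0 : ι → ℝ) fun i => (if i = i₀ then N else 1) * (1 / 2)) =
      ENNReal.ofReal (N * (1 / 2) ^ Fintype.card ι) := by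
    rw [Real.volume_Icc_pi, ← ENNReal.ofReal_prod_of_nonneg]
    · congr 1
      simp only [Pi.zero_apply, sub_zero, Finset.prod_mul_distrib, Finset.prod_const,
        Finset.card_univ, Finset.prod_ite_eq', Finset.mem_univ, if_true]
    · intro i _
      split_ifs <;> simp [hN.le]
  rw [← hbox]
  apply measure_mono
  rintro x ⟨hx0, hx1⟩
  -- `x = (1 - t) q + t N e₀` with `t = x₀ / N ≤ 1 / 2` and `q` in the cube.
  set t := x i₀ / N
  have hx0' := hx0 i₀
  have hx1' := hx1 i₀
  simp only [Pi.zero_apply, if_true] at hx0' hx1'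
  have ht0 : 0 ≤ t := by positivity
  have ht1 : t ≤ 1 / 2 := by
    rw [div_le_iff₀ hN]; linarith
  have ht : 0 < 1 - t := by linarith
  have hq : Function.update ((1 - t)⁻¹ • x) i₀ 0 ∈ convexHull ℝ
      (Set.Icc 0 1 ∪ {Pi.single i₀ N} : Set (ι → ℝ)) := by
    refine subset_convexHull ℝ _ (Or.inl ⟨fun i => ?_, fun i => ?_⟩)
    · by_cases h : i = i₀
      · subst h; simp
      · simpa [h] using mul_nonneg (inv_nonneg.2 ht.le) (hx0 i)
    · by_cases h : i = i₀
      · subst h; simp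
      · have := hx1 i
        simp only [h, if_false] at this
        simp only [ne_eq, h, not_false_eq_true, Function.update_of_ne, Pi.smul_apply, smul_eq_mul,
          Pi.one_apply]
        rw [inv_mul_le_iff₀ ht]
        linarith
  have hp : Pi.single i₀ N ∈ convexHull ℝ (Set.Icc 0 1 ∪ {Pi.single i₀ N} : Set (ι → ℝ)) :=
    subset_convexHull ℝ _ (Or.inr rfl)
  have := convex_convexHull ℝ _ hq hp ht.le ht0 (by ring)
  convert this using 1
  ext i
  by_cases h : i = i₀
  · subst h
    simp only [Pi.add_apply, Pi.smul_apply, Function.update_self, Pi.single_eq_same, smul_eq_mul, t]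
    field_simp
    ring
  · simp [h, mul_inv_cancel_left₀ ht.ne']

lemma exists_isCompact_volume_kFoldSumset_eq (i₀ : ι) (k : ℕ) (C : ℝ) :
    ∃ A : Set (ι → ℝ), IsCompact A ∧ 0 < volume A ∧
      volume (kFoldSumset k A) = (∑ j ∈ Finset.Icc 1 k, (j : ℝ≥0∞) ^ Fintype.card ι) * volume A ∧
      ENNReal.ofReal C * volume A < volume (convexHull ℝ A) := by
  have : Nonempty ι := ⟨i₀⟩
  set N : ℝ := max (k + 1) ((|C| + 1) * 2 ^ Fintype.card ι)
  have hNk : (k : ℝ) < N := (lt_add_one _).trans_le (le_max_left _ _)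
  have hN0 : 0 < N := (Nat.cast_nonneg k).trans_lt hNk
  have hvol : volume (Set.Icc 0 1 ∪ {Pi.single i₀ N} : Set (ι → ℝ)) = 1 := by
    have hcube : volume (Set.Icc (0 : ι → ℝ) 1) = 1 := by simp [Real.volume_Icc_pi]
    refine le_antisymm ?_ (hcube.ge.trans (measure_mono Set.subset_union_left))
    refine (measure_union_le _ _).trans ?_
    rw [hcube, measure_singleton, add_zero]
  refine ⟨Set.Icc 0 1 ∪ {Pi.single i₀ N}, isCompact_Icc.union isCompact_singleton, ?_, ?_, ?_⟩
  · rw [hvol]; exact one_pos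
  · rw [hvol, mul_one, volume_kFoldSumset_cube_union_singleton i₀ hNk]
  · rw [hvol, mul_one]
    refine lt_of_lt_of_le ?_ (le_volume_convexHull_cube_union_singleton i₀ hN0)
    have hpow : (0 : ℝ) < 2 ^ Fintype.card ι := by positivity
    have hCN : |C| + 1 ≤ N * (1 / 2) ^ Fintype.card ι := by
      rw [one_div, inv_pow, ← div_eq_mul_inv, le_div_iff₀ hpow]
      exact le_max_right _ _
    have hC := le_abs_self C
    exact (ENNReal.ofReal_lt_ofReal_iff (by positivity)).2 (by linarith)

end Sharpness

theorem theorem2 (d k : ℕ) (hd : 1 ≤ d) (hk : 1 ≤ k) :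
    (∃ C : ℝ, 0 < C ∧
      ∀ A : Set (Fin d → ℝ), NullMeasurableSet A volume →
        volume (kFoldSumset k A) < (∑ i ∈ Finset.Icc 1 k, (i : ℝ≥0∞) ^ d) * volume A →
        volume (convexHull ℝ A) ≤ ENNReal.ofReal C * volume A) ∧
    (∀ C : ℝ, ∃ A : Set (Fin d → ℝ), IsCompact A ∧ 0 < volume A ∧
      volume (kFoldSumset k A) = (∑ i ∈ Finset.Icc 1 k, (i : ℝ≥0∞) ^ d) * volume A ∧
      ENNReal.ofReal C * volume A < volume (convexHull ℝ A)) := by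
  refine ⟨exists_volume_convexHull_le d hk, fun C => ?_⟩
  simpa using exists_isCompact_volume_kFoldSumset_eq (⟨0, hd⟩ : Fin d) k C
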